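/- Let $N>1$ be an integer with prime factorization $N=\prod_{i=1}^k p_i^{n_i}$, where the $p_i$ are distinct primes and $n_i\ge 1$. Let $E$ be an elliptic curve over $\mathbb{Q}$ that has good supersingular reduction at every $p_i$. Let $L$ be a minimal $N$-torsion point field of $E$, that is, a number field of minimal degree over $\mathbb{Q}$ among all number fields over which $E$ has a point of exact order $N$. Then, for each $i$, every prime of $L$ lying above $p_i$ has ramification index $p_i^{2n_i}-p_i^{2n_i-2}$ over $p_i$, and $$[L:\mathbb{Q}]=\prod_{i=1}^k\left(p_i^{2n_i}-p_i^{2n_i-2}\right).$$ -/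

import Mathlib

open scoped NumberField WeierstrassCurve

noncomputable section

namespace WeierstrassCurve

universe u

open Classical in
/-- A Weierstrass curve over a field `k` of positive characteristic `p` is a supersingular elliptic
curve if it is nonsingular and has no nonzero `p`-torsion point over an algebraic closure of `k`.
(In characteristic zero the condition always fails, as it then says that the identity is
the only geometric point.) -/
def IsSupersingular {k : Type u} [Field k] (W : WeierstrassCurve k) : Prop :=
  W.IsElliptic ∧
    ∀ P : (W.baseChange (AlgebraicClosure k)).toAffine.Point, ringChar k • P = 0 → P = 0

/-- An elliptic curve over `ℚ` has (good) supersingular reduction at the prime `p` if a minimal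
Weierstrass equation for it over `ℤ_p` has good reduction, and the reduced curve over the residue
field is supersingular. -/
def HasSupersingularReductionAt (E : WeierstrassCurve ℚ) (p : ℕ) [Fact p.Prime] : Prop :=
  ((E.baseChange ℚ_[p]).minimal ℤ_[p]).HasGoodReduction ℤ_[p] ∧
    (((E.baseChange ℚ_[p]).minimal ℤ_[p]).reduction ℤ_[p]).IsSupersingular

open Classical in
/-- `E` has a point of exact order `m` over the field `L`. -/
def HasPointOfOrder (E : WeierstrassCurve ℚ) (m : ℕ) (L : Type u) [Field L] [Algebra ℚ L] : Prop :=
  ∃ P : (E.baseChange L).toAffine.Point, addOrderOf P = m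

/-- The number field `L` is a minimal `m`-torsion point field of `E`: `E` has a point of
exact order `m` over `L`, and `[L : ℚ]` is minimal among all number fields with this property. -/
def IsMinimalTorsionPointField (E : WeierstrassCurve ℚ) (m : ℕ) (L : Type u) [Field L]
    [NumberField L] : Prop :=
  E.HasPointOfOrder m L ∧
    ∀ (L' : Type u) [Field L'] [NumberField L'], E.HasPointOfOrder m L' →
      Module.finrank ℚ L ≤ Module.finrank ℚ L'

end WeierstrassCurve

end

/-! Fix a supersingular prime `p` dividing `N`, let `p ^ n` be its exact power in `N`, and put `M =
N / p ^ n` and `q = p ^ (2 * n) - p ^ (2 * n - 2)`. Minimality of `L` serves only to show that `L`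
is generated by the coordinates of a point `P` of order `N`. Let `K` be the field generated by `p ^
n • P`, a point of order `M` prime to `p`. The result follows from the chain, for a prime `𝔓` of `L`
over `p` and `𝔭` below it in `K`, `q ≤ e(𝔓/p) = e(𝔓/𝔭) ≤ [L : K] ≤ q`.

Lower bound (`IsSupersingularModelAt.exists_valuation_pow`): supersingularity says that the
`p`-division polynomial has no roots modulo `p`, so it reduces to a nonzero constant. Its leading
coefficient being known, its Newton polygon is a single segment, which fixes the valuation of the
`x`-coordinate of a point of order `p`. The formula `x(pP) = Φₚ / ΨSqₚ` propagates this to order `p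
^ n`. The element `x / y` then has a valuation whose `q`-th power is that of `p`, so `q` divides
`e(𝔓/p)`.

Middle equality (`ramificationIdx_eq_one_of_coprime`): at a prime of good reduction, torsion of
order prime to `p` injects under reduction. Inertia therefore fixes it, and `K` is unramified at
`p`.

Upper bound (`finrank_le_of_addOrderOf`): a `K`-embedding of `L` is determined by the image of `M •
P`, and there are at most `q` points of order `p ^ n`.

The degree formula follows by removing one prime of `N` at a time. The algebraic input is the
multiplication formula `smul_eq_zero_or_mulFormula`: it is proved where no division polynomial
vanishes, converted into polynomial recurrences over a universal curve, specialised, and recovered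
at every point from the recurrences. -/

namespace WeierstrassCurve.Affine.Point

/-! ### Addition formulas for `x`-coordinates -/

variable {F : Type*} [Field F] {W : Affine F}

/-- The `x`-coordinate of a point, with junk value `0` at the identity. -/
def xCoord : W.Point → F
  | 0 => 0
  | some x _ _ => x

/-- The `y`-coordinate of a point, with junk value `0` at the identity. -/
def yCoord : W.Point → F
  | 0 => 0
  | some _ y _ => y

/-- The value `2y + a₁x + a₃` at a point. -/
def eta (P : W.Point) : F :=
  2 * P.yCoord + W.a₁ * P.xCoord + W.a₃

@[simp]
lemma xCoord_some {x y : F} (h : W.Nonsingular x y) : (some x y h).xCoord = x := rfl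

@[simp]
lemma yCoord_some {x y : F} (h : W.Nonsingular x y) : (some x y h).yCoord = y := rfl

lemma eta_some {x y : F} (h : W.Nonsingular x y) :
    (some x y h).eta = 2 * y + W.a₁ * x + W.a₃ := rfl

@[simp]
lemma xCoord_neg (P : W.Point) : (-P).xCoord = P.xCoord := by
  rcases P with _ | _ <;> rfl

lemma nonsingular_of_ne_zero {P : W.Point} (hP : P ≠ 0) :
    W.Nonsingular P.xCoord P.yCoord := by
  rcases P with _ | ⟨x, y, h⟩
  · exact absurd rfl hP
  · exact h

lemma eq_some_of_ne_zero {P : W.Point} (hP : P ≠ 0) :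
    P = some P.xCoord P.yCoord (nonsingular_of_ne_zero hP) := by
  rcases P with _ | ⟨x, y, h⟩
  · exact absurd rfl hP
  · rfl

lemma equation_of_ne_zero {P : W.Point} (hP : P ≠ 0) :
    P.yCoord ^ 2 + W.a₁ * P.xCoord * P.yCoord + W.a₃ * P.yCoord =
      P.xCoord ^ 3 + W.a₂ * P.xCoord ^ 2 + W.a₄ * P.xCoord + W.a₆ :=
  (W.equation_iff _ _).mp (nonsingular_of_ne_zero hP).1

lemma xCoord_eq_iff {P Q : W.Point} (hP : P ≠ 0) (hQ : Q ≠ 0) :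
    P.xCoord = Q.xCoord ↔ P = Q ∨ P = -Q := by
  rw [eq_some_of_ne_zero hP, eq_some_of_ne_zero hQ]
  exact X_eq_iff

lemma eta_sq {P : W.Point} (hP : P ≠ 0) :
    P.eta ^ 2 = 4 * P.xCoord ^ 3 + W.b₂ * P.xCoord ^ 2 + 2 * W.b₄ * P.xCoord + W.b₆ := by
  have := equation_of_ne_zero hP
  simp only [eta, b₂, b₄, b₆]
  linear_combination 4 * this

variable [DecidableEq F]

lemma eta_eq_zero_iff {P : W.Point} (hP : P ≠ 0) : P.eta = 0 ↔ 2 • P = 0 := by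
  have h : P = -P ↔ 2 • P = 0 := by rw [two_nsmul, ← eq_neg_iff_add_eq_zero]
  rw [← h]
  rcases P with _ | ⟨x, y, h⟩
  · exact absurd rfl hP
  rw [neg_some, some.injEq, eta_some, negY]
  constructor
  · exact fun h ↦ ⟨rfl, by linear_combination h⟩
  · exact fun h ↦ by linear_combination h.2

lemma add_some_of_xCoord_ne {P Q : W.Point} (hP : P ≠ 0) (hQ : Q ≠ 0)
    (h : P.xCoord ≠ Q.xCoord) :
    (P + Q).xCoord = W.addX P.xCoord Q.xCoord
      ((P.yCoord - Q.yCoord) / (P.xCoord - Q.xCoord)) := by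
  rcases P with _ | ⟨x, y, hP'⟩
  · exact absurd rfl hP
  rcases Q with _ | ⟨u, v, hQ'⟩
  · exact absurd rfl hQ
  simp only [xCoord_some, yCoord_some] at h ⊢
  rw [add_of_X_ne h, xCoord_some, slope_of_X_ne h]

lemma sub_some_of_xCoord_ne {P Q : W.Point} (hP : P ≠ 0) (hQ : Q ≠ 0)
    (h : P.xCoord ≠ Q.xCoord) :
    (P - Q).xCoord = W.addX P.xCoord Q.xCoord
      ((P.yCoord - W.negY Q.xCoord Q.yCoord) / (P.xCoord - Q.xCoord)) := by
  rcases P with _ | ⟨x, y, hP'⟩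
  · exact absurd rfl hP
  rcases Q with _ | ⟨u, v, hQ'⟩
  · exact absurd rfl hQ
  simp only [xCoord_some, yCoord_some] at h ⊢
  rw [sub_eq_add_neg, neg_some, add_of_X_ne h, xCoord_some, slope_of_X_ne h]

/-- Passing from `P + Q` to `P - Q` changes the slope by `Q.eta / (x(P) - x(Q))`, and the difference
of the two values of `addX` is a product of this with a factor symmetric to it in `P`. -/
lemma xCoord_sub_sub_xCoord_add {P Q : W.Point} (hP : P ≠ 0) (hQ : Q ≠ 0)
    (h : P.xCoord ≠ Q.xCoord) :
    ((P - Q).xCoord - (P + Q).xCoord) * (P.xCoord - Q.xCoord) ^ 2 = P.eta * Q.eta := by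
  have h' := sub_ne_zero.mpr h
  rw [sub_some_of_xCoord_ne hP hQ h, add_some_of_xCoord_ne hP hQ h]
  simp only [addX, negY, eta]
  field_simp
  ring

/-- Symmetric functions of `x(P + Q)` and `x(P - Q)` are invariant under `Q ↦ -Q`, so the
`y`-coordinates can be eliminated by the curve equation. This identity for the sum and the next for
the product give recurrences in `x` alone. -/
lemma xCoord_add_add_xCoord_sub {P Q : W.Point} (hP : P ≠ 0) (hQ : Q ≠ 0)
    (h : P.xCoord ≠ Q.xCoord) :
    ((P + Q).xCoord + (P - Q).xCoord) * (P.xCoord - Q.xCoord) ^ 2 =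
      2 * P.xCoord * Q.xCoord * (P.xCoord + Q.xCoord) + W.b₂ * P.xCoord * Q.xCoord +
        W.b₄ * (P.xCoord + Q.xCoord) + W.b₆ := by
  have h' := sub_ne_zero.mpr h
  rw [sub_some_of_xCoord_ne hP hQ h, add_some_of_xCoord_ne hP hQ h]
  have e₁ := equation_of_ne_zero hP
  have e₂ := equation_of_ne_zero hQ
  simp only [addX, negY, b₂, b₄, b₆]
  field_simp
  linear_combination 2 * e₁ + 2 * e₂

lemma xCoord_add_mul_xCoord_sub {P Q : W.Point} (hP : P ≠ 0) (hQ : Q ≠ 0)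
    (h : P.xCoord ≠ Q.xCoord) :
    (P + Q).xCoord * (P - Q).xCoord * (P.xCoord - Q.xCoord) ^ 2 =
      P.xCoord ^ 2 * Q.xCoord ^ 2 - W.b₄ * P.xCoord * Q.xCoord -
        W.b₆ * (P.xCoord + Q.xCoord) - W.b₈ := by
  have h' := sub_ne_zero.mpr h
  rw [sub_some_of_xCoord_ne hP hQ h, add_some_of_xCoord_ne hP hQ h]
  have e₁ := equation_of_ne_zero hP
  have e₂ := equation_of_ne_zero hQ
  simp only [addX, negY, b₄, b₆, b₈]
  generalize P.xCoord = x at *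
  generalize Q.xCoord = u at *
  generalize P.yCoord = y at *
  generalize Q.yCoord = v at *
  field_simp
  grind

lemma xCoord_two_smul_mul {P : W.Point} (hP : P ≠ 0) (h : P.eta ≠ 0) :
    (2 • P).xCoord * P.eta ^ 2 =
      P.xCoord ^ 4 - W.b₄ * P.xCoord ^ 2 - 2 * W.b₆ * P.xCoord - W.b₈ := by
  have e := equation_of_ne_zero hP
  rcases P with _ | ⟨x, y, hxy⟩
  · exact absurd rfl hP
  have hy : y ≠ W.negY x y := by
    intro hy
    apply h
    rw [negY] at hy
    rw [eta_some]
    linear_combination hy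
  rw [two_nsmul, add_self_of_Y_ne hy, xCoord_some, slope_of_Y_ne rfl hy]
  rw [eta_some] at h ⊢
  simp only [xCoord_some, yCoord_some] at e ⊢
  have e' : y - W.negY x y = 2 * y + W.a₁ * x + W.a₃ := by rw [negY]; ring
  rw [e']
  simp only [addX, b₄, b₆, b₈]
  generalize hd : 2 * y + W.a₁ * x + W.a₃ = d at h ⊢
  clear e' hy
  field_simp
  subst hd
  grind
end WeierstrassCurve.Affine.Point

/-! ### Multiplication formula at points where no division polynomial vanishes -/

namespace WeierstrassCurve.Affine.Point

variable {F : Type*} [Field F] {W : Affine F}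

/-- The value of the `n`-th division polynomial at a point. -/
noncomputable def psi (P : W.Point) (n : ℤ) : F :=
  normEDS P.eta (W.Ψ₃.eval P.xCoord) (W.preΨ₄.eval P.xCoord) n

section Psi

variable (P : W.Point)

@[simp] lemma psi_zero : P.psi 0 = 0 := normEDS_zero ..

@[simp] lemma psi_one : P.psi 1 = 1 := normEDS_one ..

@[simp] lemma psi_two : P.psi 2 = P.eta := normEDS_two ..

@[simp] lemma psi_neg (n : ℤ) : P.psi (-n) = -P.psi n := normEDS_neg ..

lemma psi_three : P.psi 3 = 3 * P.xCoord ^ 4 + W.b₂ * P.xCoord ^ 3 + 3 * W.b₄ * P.xCoord ^ 2 +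
    3 * W.b₆ * P.xCoord + W.b₈ := by
  simp [psi, Ψ₃]

lemma psi_four : P.psi 4 = (2 * P.xCoord ^ 6 + W.b₂ * P.xCoord ^ 5 + 5 * W.b₄ * P.xCoord ^ 4 +
    10 * W.b₆ * P.xCoord ^ 3 + 10 * W.b₈ * P.xCoord ^ 2 +
    (W.b₂ * W.b₈ - W.b₄ * W.b₆) * P.xCoord + (W.b₄ * W.b₈ - W.b₆ ^ 2)) * P.eta := by
  simp [psi, preΨ₄]

lemma psi_even (m : ℤ) : P.psi (2 * m) * P.eta = P.psi (m - 1) ^ 2 * P.psi m * P.psi (m + 2) -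
    P.psi (m - 2) * P.psi m * P.psi (m + 1) ^ 2 := normEDS_even ..

lemma psi_odd (m : ℤ) : P.psi (2 * m + 1) = P.psi (m + 2) * P.psi m ^ 3 -
    P.psi (m - 1) * P.psi (m + 1) ^ 3 := normEDS_odd ..

end Psi

variable [DecidableEq F]

/-- The multiplication formula `x(nP) = x(P) - ψₙ₊₁(P)ψₙ₋₁(P) / ψₙ(P)²` in denominator-free form,
together with the nonvanishing of `nP`. -/
def MulFormula (P : W.Point) (n : ℤ) : Prop :=
  n • P ≠ 0 ∧ (P.xCoord - (n • P).xCoord) * P.psi n ^ 2 = P.psi (n + 1) * P.psi (n - 1)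

section MulFormula

variable {P : W.Point} (hP : P ≠ 0)
include hP

lemma mulFormula_one : P.MulFormula 1 := by
  simp [MulFormula, hP]

lemma mulFormula_two (h : P.eta ≠ 0) : P.MulFormula 2 := by
  have h2 : (2 : ℤ) • P = 2 • P := by rw [← natCast_zsmul]; rfl
  refine ⟨by rwa [h2, Ne, ← eta_eq_zero_iff hP], ?_⟩
  norm_num
  rw [h2, psi_three]
  linear_combination P.xCoord * eta_sq hP - xCoord_two_smul_mul hP h

omit hP in
lemma xCoord_smul_ne {m : ℤ} (hm : P.MulFormula m) (h₁ : P.psi (m + 1) ≠ 0)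
    (h₂ : P.psi (m - 1) ≠ 0) : (m • P).xCoord ≠ P.xCoord := by
  intro h
  have := hm.2
  rw [h, sub_self, zero_mul] at this
  exact mul_ne_zero h₁ h₂ this.symm

lemma mulFormula_three (h₂ : P.eta ≠ 0) (h₃ : P.psi 3 ≠ 0) : P.MulFormula 3 := by
  have T := mulFormula_two hP h₂
  have hx : ((2 : ℤ) • P).xCoord ≠ P.xCoord := xCoord_smul_ne T (by simpa using h₃) (by simp)
  have e3 : (3 : ℤ) • P = (2 : ℤ) • P + P := by rw [← add_one_zsmul]; rfl
  have e1 : (2 : ℤ) • P - P = P := by rw [two_zsmul]; abel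
  have hne : (3 : ℤ) • P ≠ 0 := by
    intro h
    rw [e3] at h
    exact hx (((xCoord_eq_iff T.1 hP).mpr (Or.inr (eq_neg_of_add_eq_zero_left h))))
  refine ⟨hne, ?_⟩
  have G := xCoord_add_add_xCoord_sub T.1 hP hx
  rw [← e3, e1] at G
  have hb := eta_sq hP
  have hT := T.2
  have h2 : (2 : ℤ) • P = 2 • P := by rw [← natCast_zsmul]; rfl
  have hd := xCoord_two_smul_mul hP h₂
  rw [← h2] at hd
  norm_num at hT ⊢
  have r := W.b_relation
  rw [psi_four]
  rw [psi_three] at hT ⊢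
  set x := P.xCoord
  set u := ((2 : ℤ) • P).xCoord
  set v := ((3 : ℤ) • P).xCoord
  set e := P.eta
  linear_combination -(x - v) * (3 * x ^ 4 + W.b₂ * x ^ 3 + 3 * W.b₄ * x ^ 2 + 3 * W.b₆ * x + W.b₈ +
    (x - u) * e ^ 2) * hT - e ^ 4 * G - (6 * x ^ 2 + W.b₂ * x + W.b₄) * e ^ 2 * hd +
    (2 * x ^ 3 - W.b₄ * x - W.b₆) * e ^ 2 * hb - x ^ 2 * e ^ 2 * r

/-- This is the composition law `ψ₂ₘ(P) = ψₘ(P)⁴ ψ₂(mP)`. The even recurrence expresses `ψ₂ₘ`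
through the difference of `x((m - 1)P)` and `x((m + 1)P)`, which is a product of two values of
`eta`. -/
lemma psi_two_mul_eq {m : ℤ} (hb : P.eta ≠ 0) (h₀ : P.MulFormula (m - 1))
    (h₁ : P.MulFormula m) (h₂ : P.MulFormula (m + 1)) (hx : (m • P).xCoord ≠ P.xCoord) :
    P.psi (2 * m) = P.psi m ^ 4 * (m • P).eta := by
  have G := xCoord_sub_sub_xCoord_add h₁.1 hP hx
  have ha : m • P + P = (m + 1) • P := by rw [add_zsmul, one_zsmul]
  have hs : m • P - P = (m - 1) • P := by rw [sub_zsmul, one_zsmul, sub_eq_add_neg]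
  rw [ha, hs] at G
  have t₀ := h₀.2
  have t₁ := h₁.2
  have t₂ := h₂.2
  rw [show m - 1 + 1 = m by ring, show m - 1 - 1 = m - 2 by ring] at t₀
  rw [show m + 1 + 1 = m + 2 by ring, show m + 1 - 1 = m by ring] at t₂
  have r := P.psi_even m
  apply mul_right_cancel₀ hb
  linear_combination r - P.psi (m - 1) ^ 2 * t₂ + P.psi (m + 1) ^ 2 * t₀ + P.psi m ^ 4 * G -
    (((m - 1) • P).xCoord - ((m + 1) • P).xCoord) * (P.psi (m + 1) * P.psi (m - 1) +
      (P.xCoord - (m • P).xCoord) * P.psi m ^ 2) * t₁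

omit hP in
lemma psi_two_mul_add_one_eq {m : ℤ} (h₁ : P.MulFormula m) (h₂ : P.MulFormula (m + 1)) :
    P.psi (2 * m + 1) = P.psi m ^ 2 * P.psi (m + 1) ^ 2 *
      ((m • P).xCoord - ((m + 1) • P).xCoord) := by
  have t₁ := h₁.2
  have t₂ := h₂.2
  rw [show m + 1 + 1 = m + 2 by ring, show m + 1 - 1 = m by ring] at t₂
  rw [psi_odd]
  linear_combination P.psi (m + 1) ^ 2 * t₁ - P.psi m ^ 2 * t₂

lemma mulFormula_even {m : ℤ} (hb : P.eta ≠ 0) (h₀ : P.MulFormula (m - 1))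
    (h₁ : P.MulFormula m) (h₂ : P.MulFormula (m + 1)) (hx : (m • P).xCoord ≠ P.xCoord)
    (hn : P.psi (2 * m) ≠ 0) : P.MulFormula (2 * m) := by
  have hd := psi_two_mul_eq hP hb h₀ h₁ h₂ hx
  have he : (m • P).eta ≠ 0 := by
    rintro h
    rw [h, mul_zero] at hd
    exact hn hd
  have e2 : (2 * m) • P = 2 • (m • P) := by rw [mul_zsmul, two_zsmul, two_nsmul]
  refine ⟨?_, ?_⟩
  · rw [e2]
    rwa [Ne, ← eta_eq_zero_iff h₁.1]
  have o₁ := psi_two_mul_add_one_eq h₁ h₂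
  have o₀ := psi_two_mul_add_one_eq (m := m - 1) h₀ (by rwa [sub_add_cancel])
  rw [show 2 * (m - 1) + 1 = 2 * m - 1 by ring, sub_add_cancel] at o₀
  have ha : m • P + P = (m + 1) • P := by rw [add_zsmul, one_zsmul]
  have hs : m • P - P = (m - 1) • P := by rw [sub_zsmul, one_zsmul, sub_eq_add_neg]
  have G2 := xCoord_add_add_xCoord_sub h₁.1 hP hx
  have G3 := xCoord_add_mul_xCoord_sub h₁.1 hP hx
  rw [ha, hs] at G2 G3
  have G4 := xCoord_two_smul_mul h₁.1 he
  have E := eta_sq h₁.1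
  have t₁ := h₁.2
  rw [hd, o₁, o₀, e2]
  generalize (2 • m • P).xCoord = x2 at *
  generalize ((m + 1) • P).xCoord = xp at *
  generalize ((m - 1) • P).xCoord = xl at *
  generalize (m • P).xCoord = xm at *
  generalize (m • P).eta = e at *
  generalize P.xCoord = x at *
  generalize P.psi m = s at *
  have key : (x - x2) * e ^ 2 = (xm - x) ^ 2 * ((xm - xp) * (xl - xm)) := by
    linear_combination x * E - G4 - xm * G2 + G3
  have : P.psi (m + 1) ^ 2 * P.psi (m - 1) ^ 2 = ((x - xm) * s ^ 2) ^ 2 := by rw [t₁]; ring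
  linear_combination s ^ 8 * key - s ^ 4 * ((xm - xp) * (xl - xm)) * this

omit hP in
lemma mulFormula_odd {m : ℤ} (h₁ : P.MulFormula m) (h₂ : P.MulFormula (m + 1))
    (d₁ : P.psi (2 * m) = P.psi m ^ 4 * (m • P).eta)
    (d₂ : P.psi (2 * (m + 1)) = P.psi (m + 1) ^ 4 * ((m + 1) • P).eta)
    (hn : P.psi (2 * m + 1) ≠ 0) : P.MulFormula (2 * m + 1) := by
  have o := psi_two_mul_add_one_eq h₁ h₂
  have hx : ((m + 1) • P).xCoord ≠ (m • P).xCoord := by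
    rintro h
    rw [h, sub_self, mul_zero] at o
    exact hn o
  have ha : (m + 1) • P + m • P = (2 * m + 1) • P := by rw [← add_zsmul]; congr 1; ring
  have hs : (m + 1) • P - m • P = P := by
    rw [add_zsmul, one_zsmul, add_sub_cancel_left]
  have G := xCoord_sub_sub_xCoord_add h₂.1 h₁.1 hx
  rw [ha, hs] at G
  refine ⟨?_, ?_⟩
  · rw [← ha]
    intro h
    exact hx ((xCoord_eq_iff h₂.1 h₁.1).mpr (Or.inr (eq_neg_of_add_eq_zero_left h)))
  rw [show 2 * m + 1 + 1 = 2 * (m + 1) by ring, show 2 * m + 1 - 1 = 2 * m by ring, d₁, d₂, o]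
  linear_combination P.psi m ^ 4 * P.psi (m + 1) ^ 4 * G

/-- The recurrences defining `psi` halve the index, so the induction is strong and splits by parity.
Nonvanishing of all `psi` keeps the points involved at distinct `x`-coordinates, where the chord
formulas apply. -/
theorem mulFormula_of_forall_psi_ne_zero (h : ∀ n : ℕ, n ≠ 0 → P.psi n ≠ 0) (n : ℕ) (hn : n ≠ 0) :
    P.MulFormula n := by
  have hb : P.eta ≠ 0 := by simpa using h 2 two_ne_zero
  have hx (m : ℕ) (hm : 2 ≤ m) (hf : P.MulFormula m) : ((m : ℤ) • P).xCoord ≠ P.xCoord := by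
    refine xCoord_smul_ne hf (by exact_mod_cast h (m + 1) (by omega)) ?_
    have := h (m - 1) (by omega)
    rwa [Nat.cast_sub (by omega), Nat.cast_one] at this
  induction n using Nat.strong_induction_on with
  | _ n ih =>
    have ih' (k : ℤ) (h0 : 0 < k) (hk : k < n) : P.MulFormula k := by
      lift k to ℕ using h0.le
      exact ih k (by omega) (by omega)
    obtain rfl | rfl | rfl | hn4 : n = 1 ∨ n = 2 ∨ n = 3 ∨ 4 ≤ n := by omega
    · exact mulFormula_one hP
    · exact mulFormula_two hP hb
    · exact mulFormula_three hP hb (by simpa using h 3 three_ne_zero)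
    · obtain ⟨m, rfl | rfl⟩ := n.even_or_odd'
      · have h1 := ih' m (by omega) (by omega)
        have := mulFormula_even hP (m := m) hb (ih' _ (by omega) (by omega)) h1
          (ih' _ (by omega) (by omega)) (hx m (by omega) h1) (by exact_mod_cast h (2 * m) hn)
        exact_mod_cast this
      · have h1 := ih' m (by omega) (by omega)
        have h2 := ih' (m + 1) (by omega) (by omega)
        have := mulFormula_odd (m := m) h1 h2
          (psi_two_mul_eq hP hb (ih' _ (by omega) (by omega)) h1 h2 (hx m (by omega) h1))
          (psi_two_mul_eq hP hb (by rwa [add_sub_cancel_right]) h2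
            (ih' _ (by omega) (by omega)) (by exact_mod_cast hx (m + 1) (by omega) h2))
          (by exact_mod_cast h (2 * m + 1) hn)
        exact_mod_cast this

end MulFormula

end WeierstrassCurve.Affine.Point

/-! ### Recurrences of step one for division polynomials, by a universal curve -/

namespace WeierstrassCurve.Affine.Point

variable {F : Type*} [Field F] {W : Affine F}

section

variable [DecidableEq F] {P : W.Point} (hP : P ≠ 0) (h : ∀ n : ℕ, n ≠ 0 → P.psi n ≠ 0)
include hP h

/-- The product and the sum of `x(P) - x((n + 1)P)` and `x(P) - x((n - 1)P)` are known by the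
addition formulas; rewriting each difference by the multiplication formula gives the two relations.
Being polynomial identities, they will survive specialisation to points where some `psi` vanishes.
-/
lemma psi_relations_of_forall_psi_ne_zero (n : ℕ) (hn : n ≠ 0) :
    P.psi (n + 2) * P.psi (n - 2) =
        P.eta ^ 2 * P.psi (n + 1) * P.psi (n - 1) - P.psi 3 * P.psi n ^ 2 ∧
      P.psi (n + 2) * P.psi (n - 1) ^ 2 + P.psi (n - 2) * P.psi (n + 1) ^ 2 +
          P.eta ^ 2 * P.psi n ^ 3 =
        (6 * P.xCoord ^ 2 + W.b₂ * P.xCoord + W.b₄) * P.psi (n + 1) * P.psi n * P.psi (n - 1) := by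
  obtain rfl | hn2 : n = 1 ∨ 2 ≤ n := by omega
  · norm_num
  have T (k : ℤ) (hk : 0 < k) : P.MulFormula k := by
    lift k to ℕ using hk.le
    exact mulFormula_of_forall_psi_ne_zero hP h k (by omega)
  have ne (k : ℤ) (hk : 0 < k) : P.psi k ≠ 0 := by
    lift k to ℕ using hk.le
    exact h k (by omega)
  have h₁ := T n (by omega)
  have t₀ := (T (n - 1) (by omega)).2
  have t₂ := (T (n + 1) (by omega)).2
  have t₁ := h₁.2
  have hx := xCoord_smul_ne h₁ (ne _ (by omega)) (ne _ (by omega))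
  have hs := ne n (by omega)
  have ha : (n : ℤ) • P + P = ((n : ℤ) + 1) • P := by rw [add_zsmul, one_zsmul]
  have hs' : (n : ℤ) • P - P = ((n : ℤ) - 1) • P := by
    rw [sub_zsmul, one_zsmul, sub_eq_add_neg]
  have G2 := xCoord_add_add_xCoord_sub h₁.1 hP hx
  have G3 := xCoord_add_mul_xCoord_sub h₁.1 hP hx
  rw [ha, hs'] at G2 G3
  have E := eta_sq hP
  rw [show (n : ℤ) - 1 + 1 = n by ring, show (n : ℤ) - 1 - 1 = n - 2 by ring] at t₀
  rw [show (n : ℤ) + 1 + 1 = n + 2 by ring, show (n : ℤ) + 1 - 1 = n by ring] at t₂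
  have h3 := psi_three P
  generalize P.psi 3 = c at *
  generalize P.psi n = s2 at *
  generalize P.psi (n + 1) = s3 at *
  generalize P.psi (n + 2) = s4 at *
  generalize P.psi (n - 1) = s1 at *
  generalize P.psi (n - 2) = s0 at *
  generalize (((n : ℤ) + 1) • P).xCoord = xp at *
  generalize (((n : ℤ) - 1) • P).xCoord = xl at *
  generalize ((n : ℤ) • P).xCoord = u at *
  generalize P.eta = e at *
  generalize P.xCoord = x at *
  have t₁' : s1 ^ 2 * s3 ^ 2 = (x - u) ^ 2 * s2 ^ 4 := by
    linear_combination -(s3 * s1 + (x - u) * s2 ^ 2) * t₁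
  have q1 : (x - u) ^ 2 * ((x - xp) * (x - xl)) = e ^ 2 * (x - u) - c := by
    rw [h3, E]
    linear_combination G3 - x * G2
  have q2 : (x - u) ^ 2 * ((x - xp) + (x - xl)) + e ^ 2 =
      (6 * x ^ 2 + W.b₂ * x + W.b₄) * (x - u) := by
    rw [E]
    linear_combination - G2
  constructor
  · apply mul_right_cancel₀ (pow_ne_zero 2 hs)
    linear_combination (-(s0 * s2) * t₂ - (x - xp) * s3 ^ 2 * t₀ + s2 ^ 4 * q1 +
      (x - xp) * (x - xl) * t₁' + e ^ 2 * s2 ^ 2 * t₁)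
  · apply mul_right_cancel₀ hs
    linear_combination (-s1 ^ 2 * t₂ - s3 ^ 2 * t₀ + s2 ^ 4 * q2 +
      ((x - xp) + (x - xl)) * t₁' + (6 * x ^ 2 + W.b₂ * x + W.b₄) * s2 ^ 2 * t₁)

end

end WeierstrassCurve.Affine.Point

/-- The additive group of a cuspidal cubic realises this sequence; it witnesses that no term of the
universal sequence of positive index is zero. -/
lemma normEDS_two_three_two (n : ℕ) : normEDS (2 : ℤ) 3 2 n = n := by
  induction n using normEDSRec with
  | zero => simp
  | one => simp
  | two => simp
  | three => simp
  | four => simp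
  | even m h1 h2 h3 h4 h5 =>
    have := normEDS_even (2 : ℤ) 3 2 (m + 3)
    rw [show (m : ℤ) + 3 - 1 = (m + 2 : ℕ) by push_cast; ring,
      show (m : ℤ) + 3 - 2 = (m + 1 : ℕ) by push_cast; ring,
      show (m : ℤ) + 3 + 1 = (m + 4 : ℕ) by push_cast; ring,
      show (m : ℤ) + 3 + 2 = (m + 5 : ℕ) by push_cast; ring,
      show (m : ℤ) + 3 = (m + 3 : ℕ) by push_cast; ring, h1, h2, h3, h4, h5] at this
    push_cast at this ⊢
    linarith
  | odd m h1 h2 h3 h4 =>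
    have := normEDS_odd (2 : ℤ) 3 2 (m + 2)
    rw [show (m : ℤ) + 2 - 1 = (m + 1 : ℕ) by push_cast; ring,
      show (m : ℤ) + 2 + 1 = (m + 3 : ℕ) by push_cast; ring,
      show (m : ℤ) + 2 + 2 = (m + 4 : ℕ) by push_cast; ring,
      show (m : ℤ) + 2 = (m + 2 : ℕ) by push_cast; ring, h1, h2, h3, h4] at this
    push_cast at this ⊢
    linarith

namespace WeierstrassCurve

open MvPolynomial

/-- The universal Weierstrass curve passing through the origin. -/
noncomputable def universalAtOrigin : WeierstrassCurve (MvPolynomial (Fin 4) ℤ) :=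
  ⟨X 0, X 1, X 2, X 3, 0⟩

/-- The elliptic divisibility sequence of the origin on a Weierstrass curve. -/
noncomputable def originEDS {R : Type*} [CommRing R] (W : WeierstrassCurve R) (n : ℤ) : R :=
  normEDS W.a₃ W.b₈ (W.b₄ * W.b₈ - W.b₆ ^ 2) n

lemma map_originEDS {R S : Type*} [CommRing R] [CommRing S] (f : R →+* S) (W : WeierstrassCurve R)
    (n : ℤ) : (W.map f).originEDS n = f (W.originEDS n) := by
  simp [originEDS]

lemma universalAtOrigin_originEDS_ne_zero (n : ℕ) (hn : n ≠ 0) :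
    universalAtOrigin.originEDS n ≠ 0 := by
  intro h
  -- This is the cuspidal cubic `(y + 1)² = (x + 1)³`, for which `a₃ = 2`, `b₈ = 3` and `b₄ b₈ - b₆²
  -- = 2`.
  have := congrArg (eval₂Hom (Int.castRingHom ℤ) ![0, 3, 2, 3]) h
  rw [← map_originEDS] at this
  have h1 : (universalAtOrigin.map (eval₂Hom (Int.castRingHom ℤ) ![0, 3, 2, 3])) =
      ⟨0, 3, 2, 3, 0⟩ := by
    ext <;> simp [universalAtOrigin]
  rw [h1, originEDS] at this
  simp [b₄, b₆, b₈, -normEDS_ofNat] at this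
  rw [normEDS_two_three_two] at this
  exact hn (by exact_mod_cast this)

/-- Over the fraction field the origin is a nonsingular point at which no `psi` of positive index
vanishes, so the relations hold there; the coefficient ring embeds in its fraction field. -/
lemma universalAtOrigin_relations (n : ℕ) (hn : n ≠ 0) :
    let W := universalAtOrigin
    W.originEDS (n + 2) * W.originEDS (n - 2) =
        W.a₃ ^ 2 * W.originEDS (n + 1) * W.originEDS (n - 1) - W.b₈ * W.originEDS n ^ 2 ∧
      W.originEDS (n + 2) * W.originEDS (n - 1) ^ 2 +
          W.originEDS (n - 2) * W.originEDS (n + 1) ^ 2 + W.a₃ ^ 2 * W.originEDS n ^ 3 =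
        W.b₄ * W.originEDS (n + 1) * W.originEDS n * W.originEDS (n - 1) := by
  classical
  intro W
  let K := FractionRing (MvPolynomial (Fin 4) ℤ)
  let f : MvPolynomial (Fin 4) ℤ →+* K := algebraMap _ _
  have hf : Function.Injective f := IsFractionRing.injective _ _
  have hns : (W.map f).toAffine.Nonsingular 0 0 := by
    rw [Affine.nonsingular_iff, Affine.equation_iff]
    refine ⟨by simp [W, universalAtOrigin], Or.inr ?_⟩
    simp only [map_a₁, map_a₃, W, universalAtOrigin]
    rw [mul_zero, neg_zero, sub_zero, zero_sub, Ne, eq_comm, neg_eq_zero]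
    rw [map_eq_zero_iff _ hf]
    exact X_ne_zero _
  let P : (W.map f).toAffine.Point := .some 0 0 hns
  have hpsi (k : ℤ) : P.psi k = f (W.originEDS k) := by
    rw [← map_originEDS]
    simp [Affine.Point.psi, P, Affine.Point.eta_some, originEDS, Ψ₃, preΨ₄]
  have key := Affine.Point.psi_relations_of_forall_psi_ne_zero (P := P)
    (Affine.Point.some_ne_zero _) (fun k hk ↦ by
      rw [hpsi, Ne, map_eq_zero_iff _ hf]
      exact universalAtOrigin_originEDS_ne_zero k hk) n hn
  rw [Affine.Point.psi_three, show P.eta = f W.a₃ by simp [P, Affine.Point.eta_some],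
    show P.xCoord = 0 from rfl, map_b₂, map_b₄, map_b₆, map_b₈] at key
  simp only [hpsi, ← map_mul, ← map_pow, ← map_add, ← map_sub, mul_zero, zero_add, ne_eq,
    OfNat.ofNat_ne_zero, not_false_eq_true, zero_pow, add_zero] at key
  exact ⟨hf key.1, hf key.2⟩

namespace Affine.Point

variable {F : Type*} [Field F] {W : Affine F} {P : W.Point} (hP : P ≠ 0)
include hP

/-- Translating the point to the origin makes the curve a specialisation of the universal one, and
leaves the quantities occurring in the relations unchanged. -/
lemma psi_eq_originEDS : ∃ f : MvPolynomial (Fin 4) ℤ →+* F,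
    P.eta = f universalAtOrigin.a₃ ∧ P.psi 3 = f universalAtOrigin.b₈ ∧
    6 * P.xCoord ^ 2 + W.b₂ * P.xCoord + W.b₄ = f universalAtOrigin.b₄ ∧
    ∀ n, P.psi n = f (universalAtOrigin.originEDS n) := by
  let x := P.xCoord
  let y := P.yCoord
  have e : y ^ 2 + W.a₁ * x * y + W.a₃ * y =
      x ^ 3 + W.a₂ * x ^ 2 + W.a₄ * x + W.a₆ := equation_of_ne_zero hP
  have h6 : W.a₆ = y ^ 2 + W.a₁ * x * y + W.a₃ * y - (x ^ 3 + W.a₂ * x ^ 2 + W.a₄ * x) := by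
    linear_combination -e
  -- These are the coefficients of the curve after the translation by `(x, y)`.
  let f := eval₂Hom (Int.castRingHom F) ![W.a₁, W.a₂ + 3 * x, W.a₃ + W.a₁ * x + 2 * y,
    3 * x ^ 2 + 2 * W.a₂ * x + W.a₄ - W.a₁ * y]
  let W' : WeierstrassCurve F := ⟨W.a₁, W.a₂ + 3 * x, W.a₃ + W.a₁ * x + 2 * y,
    3 * x ^ 2 + 2 * W.a₂ * x + W.a₄ - W.a₁ * y, 0⟩
  have hW : universalAtOrigin.map f = W' := by
    ext <;> simp [universalAtOrigin, f, W']
  have h3 : P.eta = W'.a₃ := by simp only [W', eta, x, y]; ring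
  have h8 : P.psi 3 = W'.b₈ := by
    rw [psi_three]
    change 3 * x ^ 4 + W.b₂ * x ^ 3 + 3 * W.b₄ * x ^ 2 + 3 * W.b₆ * x + W.b₈ = _
    simp only [W', b₂, b₄, b₆, b₈, h6]
    ring
  have h4 : 6 * P.xCoord ^ 2 + W.b₂ * P.xCoord + W.b₄ = W'.b₄ := by
    change 6 * x ^ 2 + W.b₂ * x + W.b₄ = _
    simp only [W', b₂, b₄]
    ring
  have h34 : W.preΨ₄.eval P.xCoord = W'.b₄ * W'.b₈ - W'.b₆ ^ 2 := by
    rw [← h8, psi_three]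
    change W.preΨ₄.eval x =
      _ * (3 * x ^ 4 + W.b₂ * x ^ 3 + 3 * W.b₄ * x ^ 2 + 3 * W.b₆ * x + W.b₈) - _
    simp [preΨ₄]
    simp only [W', b₂, b₄, b₆, b₈, h6]
    ring
  refine ⟨f, ?_, ?_, ?_, fun n ↦ ?_⟩
  · rw [h3, ← hW, map_a₃]
  · rw [h8, ← hW, map_b₈]
  · rw [h4, ← hW, map_b₄]
  · rw [← map_originEDS, hW, originEDS, psi, h34, h3, ← h8]
    simp [psi]

theorem psi_relations (n : ℕ) (hn : n ≠ 0) :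
    P.psi (n + 2) * P.psi (n - 2) =
        P.eta ^ 2 * P.psi (n + 1) * P.psi (n - 1) - P.psi 3 * P.psi n ^ 2 ∧
      P.psi (n + 2) * P.psi (n - 1) ^ 2 + P.psi (n - 2) * P.psi (n + 1) ^ 2 +
          P.eta ^ 2 * P.psi n ^ 3 =
        (6 * P.xCoord ^ 2 + W.b₂ * P.xCoord + W.b₄) * P.psi (n + 1) * P.psi n * P.psi (n - 1) := by
  obtain ⟨f, h3, h8, h4, h⟩ := psi_eq_originEDS hP
  rw [h8, h4, h3]
  simp only [h, ← map_mul, ← map_pow, ← map_add, ← map_sub]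
  exact ⟨congrArg f (universalAtOrigin_relations n hn).1,
    congrArg f (universalAtOrigin_relations n hn).2⟩

end Affine.Point

end WeierstrassCurve

/-! ### Multiplication formula at every point -/

namespace WeierstrassCurve.Affine.Point

variable {F : Type*} [Field F] {W : Affine F} {P : W.Point}

lemma psi_sq_eq (hP : P ≠ 0) (n : ℤ) : P.psi n ^ 2 = (W.ΨSq n).eval P.xCoord := by
  have h4 : P.eta ^ 4 = (W.Ψ₂Sq.eval P.xCoord) ^ 2 := by
    have := eta_sq hP
    rw [show 4 = 2 * 2 by norm_num, pow_mul, this]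
    simp [Ψ₂Sq]
  have h2 : P.eta ^ 2 = W.Ψ₂Sq.eval P.xCoord := by
    rw [eta_sq hP]
    simp [Ψ₂Sq]
  have : (W.preΨ n).eval P.xCoord = preNormEDS (P.eta ^ 4) (W.Ψ₃.eval P.xCoord)
      (W.preΨ₄.eval P.xCoord) n := by
    rw [h4, preΨ, ← Polynomial.coe_evalRingHom, map_preNormEDS]
    simp
  rw [psi, normEDS, ← this, ΨSq]
  split_ifs <;> simp [mul_pow, h2]

lemma psi_of_odd (hP : P ≠ 0) {n : ℤ} (hn : ¬ Even n) : P.psi n = (W.preΨ n).eval P.xCoord := by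
  have h4 : P.eta ^ 4 = (W.Ψ₂Sq.eval P.xCoord) ^ 2 := by
    have := eta_sq hP
    rw [show 4 = 2 * 2 by norm_num, pow_mul, this]
    simp [Ψ₂Sq]
  rw [preΨ, ← Polynomial.coe_evalRingHom, map_preNormEDS, psi, normEDS, if_neg hn, h4, mul_one]
  simp

lemma eval_Φ (hP : P ≠ 0) (n : ℤ) :
    (W.Φ n).eval P.xCoord = P.xCoord * P.psi n ^ 2 - P.psi (n + 1) * P.psi (n - 1) := by
  have h4 : P.eta ^ 4 = (W.Ψ₂Sq.eval P.xCoord) ^ 2 := by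
    have := eta_sq hP
    rw [show 4 = 2 * 2 by norm_num, pow_mul, this]
    simp [Ψ₂Sq]
  have h2 : P.eta ^ 2 = W.Ψ₂Sq.eval P.xCoord := by
    rw [eta_sq hP]
    simp [Ψ₂Sq]
  have pre (n : ℤ) : (W.preΨ n).eval P.xCoord = preNormEDS (P.eta ^ 4) (W.Ψ₃.eval P.xCoord)
      (W.preΨ₄.eval P.xCoord) n := by
    rw [h4, preΨ, ← Polynomial.coe_evalRingHom, map_preNormEDS]
    simp
  rw [WeierstrassCurve.Φ, psi_sq_eq hP, psi, psi, normEDS, normEDS, ← pre, ← pre]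
  by_cases hn : Even n
  · have h1 : ¬ Even (n + 1) := by simpa [Int.even_add_one] using hn
    have h2 : ¬ Even (n - 1) := by simpa [Int.even_sub_one] using hn
    simp [hn, h1, h2]
  · have h1 : Even (n + 1) := by simpa [Int.even_add_one] using hn
    have h2' : Even (n - 1) := by simpa [Int.even_sub_one] using hn
    simp only [hn, h1, h2', if_true, if_false]
    simp
    rw [← h2]
    ring

/-- When the `Y`-derivative vanishes, `ψ₃` equals minus the square of the `X`-derivative, which is
then nonzero by nonsingularity. -/
lemma psi_three_ne_zero_of_eta_eq_zero (hP : P ≠ 0) (h : P.eta = 0) : P.psi 3 ≠ 0 := by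
  have hns := nonsingular_of_ne_zero hP
  have e := equation_of_ne_zero hP
  rw [nonsingular_iff] at hns
  rw [psi_three]
  simp only [eta] at h
  generalize P.xCoord = x at *
  generalize P.yCoord = y at *
  intro h3
  have hY : y = -y - W.a₁ * x - W.a₃ := by linear_combination h
  refine hns.2.elim (fun hX ↦ hX ?_) (fun hY' ↦ hY' hY)
  have : (W.a₁ * y - (3 * x ^ 2 + 2 * W.a₂ * x + W.a₄)) ^ 2 = 0 := by
    have h3' : W.a₃ = -2 * y - W.a₁ * x := by linear_combination h
    have h6 : W.a₆ = y ^ 2 + W.a₁ * x * y + W.a₃ * y - (x ^ 3 + W.a₂ * x ^ 2 + W.a₄ * x) := by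
      linear_combination -e
    simp only [b₂, b₄, b₆, b₈, h6, h3'] at h3
    linear_combination -h3
  linear_combination pow_eq_zero_iff two_ne_zero |>.mp this

/-- At even index `eta` is a factor. At odd index exactly one of the two products in the odd
recurrence involves only odd indices, and it survives. -/
lemma psi_of_eta_eq_zero (hP : P ≠ 0) (h : P.eta = 0) (n : ℕ) :
    (Even n → P.psi n = 0) ∧ (¬ Even n → P.psi n ≠ 0) := by
  refine ⟨fun hn ↦ ?_, ?_⟩
  · rw [psi, normEDS, if_pos (by exact_mod_cast hn), h, mul_zero]
  induction n using Nat.strong_induction_on with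
  | _ n ih =>
    intro hn
    have h0 (k : ℤ) (hk : Even k) : P.psi k = 0 := by
      rw [psi, normEDS, if_pos hk, h, mul_zero]
    have h1 (k : ℤ) (hk0 : 0 < k) (hk : ¬ Even k) (hlt : k < n) : P.psi k ≠ 0 := by
      lift k to ℕ using hk0.le
      exact ih k (by exact_mod_cast hlt) (by exact_mod_cast hk)
    obtain ⟨m, rfl⟩ := Nat.not_even_iff_odd.mp hn
    obtain rfl | rfl | hm : m = 0 ∨ m = 1 ∨ 2 ≤ m := by omega
    · simp
    · simpa using psi_three_ne_zero_of_eta_eq_zero hP h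
    · push_cast
      rw [psi_odd]
      by_cases hme : Even (m : ℤ)
      · rw [h0 m hme]
        have a1 : ¬ Even ((m : ℤ) - 1) := by simpa [Int.even_sub_one] using hme
        have a2 : ¬ Even ((m : ℤ) + 1) := by simpa [Int.even_add_one] using hme
        simpa using ⟨h1 _ (by omega) a1 (by push_cast; omega),
          h1 _ (by omega) a2 (by push_cast; omega)⟩
      · have a1 : Even ((m : ℤ) - 1) := by simpa [Int.even_sub_one] using hme
        have a2 : ¬ Even ((m : ℤ) + 2) := by simpa [Int.even_add] using hme
        rw [h0 _ a1]
        simpa using ⟨h1 _ (by omega) a2 (by push_cast; omega),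
          h1 _ (by omega) hme (by push_cast; omega)⟩

variable [DecidableEq F]

/-- The multiplication formula in terms of division polynomials. -/
theorem smul_eq_zero_or_mulFormula (hP : P ≠ 0) (n : ℕ) :
    (n • P = 0 → P.psi n = 0) ∧ (n • P ≠ 0 → P.psi n ≠ 0 ∧
      (P.xCoord - (n • P).xCoord) * P.psi n ^ 2 = P.psi (n + 1) * P.psi (n - 1)) := by
  by_cases hb : P.eta = 0
  · have h2 := (eta_eq_zero_iff hP).mp hb
    have hz := psi_of_eta_eq_zero hP hb
    obtain ⟨m, rfl | rfl⟩ := n.even_or_odd'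
    · have : (2 * m) • P = 0 := by rw [mul_comm, mul_smul, h2, smul_zero]
      exact ⟨fun _ ↦ (hz (2 * m)).1 (even_two_mul m), fun h ↦ absurd this h⟩
    · have : (2 * m + 1) • P = P := by
        rw [add_smul, mul_comm, mul_smul, h2, smul_zero, one_smul, zero_add]
      rw [this]
      refine ⟨fun h ↦ absurd h hP, fun _ ↦ ⟨(hz _).2 (by simp), ?_⟩⟩
      have := (hz (2 * m)).1 (even_two_mul m)
      push_cast at this ⊢
      rw [add_sub_cancel_right, this]
      ring
  have step (n : ℕ) : (((n + 1 : ℕ) : ℤ) + 1 = n + 2) ∧ (((n + 1 : ℕ) : ℤ) - 1 = n) := by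
    constructor <;> push_cast <;> ring
  -- The relations link consecutive indices, so the induction carries the statements for `n` and `n
  -- + 1` together.
  suffices H : ∀ n : ℕ, ((n • P = 0 → P.psi n = 0) ∧ (n • P ≠ 0 → P.psi n ≠ 0 ∧
      (P.xCoord - (n • P).xCoord) * P.psi n ^ 2 = P.psi (n + 1) * P.psi (n - 1))) ∧
      (((n + 1) • P = 0 → P.psi (n + 1) = 0) ∧ ((n + 1) • P ≠ 0 → P.psi (n + 1) ≠ 0 ∧
      (P.xCoord - ((n + 1) • P).xCoord) * P.psi (n + 1) ^ 2 = P.psi (n + 2) * P.psi n)) from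
    (H n).1
  intro n
  induction n with
  | zero => simp [hP]
  | succ n ih =>
    rw [(step n).1, (step n).2, (by push_cast; rfl : ((n + 1 : ℕ) : ℤ) = n + 1)]
    refine ⟨ih.2, ?_⟩
    obtain ⟨S, I⟩ := psi_relations hP (n + 1) n.succ_ne_zero
    rw [(step n).1, (step n).2, show ((n + 1 : ℕ) : ℤ) + 2 = n + 3 by push_cast; ring,
      show ((n + 1 : ℕ) : ℤ) - 2 = n - 1 by push_cast; ring,
      (by push_cast; rfl : ((n + 1 : ℕ) : ℤ) = n + 1)] at S I
    rw [show (n : ℤ) + 1 + 2 = n + 3 by ring]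
    have e2 : (n + 1 + 1) • P = (n + 1) • P + P := by rw [add_smul, one_smul]
    have e1 : (n + 1) • P = n • P + P := by rw [add_smul, one_smul]
    obtain ⟨⟨a0, a1⟩, b0, b1⟩ := ih
    have E := eta_sq hP
    by_cases hn1 : (n + 1) • P = 0
    · have hs := b0 hn1
      have hnP : n • P = -P := eq_neg_of_add_eq_zero_left (e1 ▸ hn1)
      obtain ⟨hn0, -⟩ := a1 (by rw [hnP]; simpa using hP)
      rw [e2, hn1, zero_add]
      refine ⟨fun h ↦ absurd h hP, fun _ ↦ ⟨?_, by rw [hs]; ring⟩⟩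
      intro h2
      have : n ≠ 0 := by rintro rfl; simp at hn0
      have I' := (psi_relations hP n this).2
      rw [h2, hs] at I'
      -- Two consecutive zeros `ψₙ₊₁ = ψₙ₊₂ = 0` would reduce the second relation at `n` to `eta²
      -- ψₙ³ = 0`.
      refine mul_ne_zero (pow_ne_zero 2 hb) (pow_ne_zero 3 hn0) ?_
      linear_combination I'
    · obtain ⟨hs1, t1⟩ := b1 hn1
      by_cases hn0 : n • P = 0
      · have hs := a0 hn0
        have e3 : (n + 1 + 1) • P = 2 • P := by rw [e2, e1, hn0, zero_add, two_nsmul]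
        have T2 := (mulFormula_two hP hb).2
        have h22 : (2 : ℤ) • P = 2 • P := by rw [← natCast_zsmul]; rfl
        norm_num [h22] at T2
        rw [e3, ← eta_eq_zero_iff hP]
        rw [hs] at I S
        refine ⟨fun h ↦ absurd h hb, fun _ ↦ ?_⟩
        -- With `ψₙ = 0` the second relation at `n + 1` reads `ψₙ₋₁ ψₙ₊₂² = -eta² ψₙ₊₁³`, so neither
        -- neighbour vanishes.
        have ne1 := mul_ne_zero (pow_ne_zero 2 hb) (pow_ne_zero 3 hs1)
        have ne2 : P.psi (n - 1) ≠ 0 := by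
          intro h
          rw [h] at I
          exact ne1 (by linear_combination I)
        refine ⟨fun h ↦ ?_, ?_⟩
        · rw [h] at I
          exact ne1 (by linear_combination I)
        · apply mul_right_cancel₀ (mul_ne_zero ne2 (pow_ne_zero 2 hb))
          linear_combination P.psi (n - 1) * P.psi (n + 2) ^ 2 * T2 + P.psi 3 * I -
            P.psi (n + 1) * P.eta ^ 2 * S
      · obtain ⟨hs0, t0⟩ := a1 hn0
        refine ⟨fun h ↦ ?_, fun h ↦ ?_⟩
        · have : (n + 1) • P = -P := eq_neg_of_add_eq_zero_left (e2 ▸ h)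
          rw [this, xCoord_neg, sub_self, zero_mul] at t1
          exact (mul_eq_zero.mp t1.symm).resolve_right hs0
        · have hx : ((n + 1) • P).xCoord ≠ P.xCoord := by
            rw [Ne, xCoord_eq_iff hn1 hP, not_or]
            constructor
            · rintro h'
              rw [e1, add_eq_right] at h'
              exact hn0 h'
            · rintro h'
              rw [e2, h', neg_add_cancel] at h
              exact h rfl
          have hs2 : P.psi (n + 2) ≠ 0 := by
            intro h'
            rw [h', zero_mul, mul_eq_zero, sub_eq_zero] at t1
            exact t1.elim (fun h ↦ hx h.symm) (pow_ne_zero 2 hs1)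
          refine ⟨hs2, ?_⟩
          have G2 := xCoord_add_add_xCoord_sub hn1 hP hx
          have hs' : (n + 1) • P - P = n • P := by rw [e1, add_sub_cancel_right]
          rw [← e2, hs'] at G2
          generalize (n • P).xCoord = xl at *
          generalize ((n + 1 + 1) • P).xCoord = xp at *
          generalize ((n + 1) • P).xCoord = u at *
          generalize P.psi (n + 3) = s3 at *
          generalize P.psi (n + 2) = s2 at *
          generalize P.psi (n + 1) = s1 at *
          generalize P.psi (n - 1) = r at *
          generalize P.psi n = s at *
          generalize P.eta = e at *
          generalize P.xCoord = x at *
          have q2 : (x - u) ^ 2 * ((x - xp) + (x - xl)) + e ^ 2 =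
              (6 * x ^ 2 + W.b₂ * x + W.b₄) * (x - u) := by
            rw [E]
            linear_combination - G2
          have t1' : s2 ^ 2 * s ^ 2 = (x - u) ^ 2 * s1 ^ 4 := by
            linear_combination -(s2 * s + (x - u) * s1 ^ 2) * t1
          apply mul_right_cancel₀ (pow_ne_zero 2 hs0)
          linear_combination s1 ^ 4 * q2 + ((x - xp) + (x - xl)) * t1' - s1 * I - s2 ^ 2 * t0 +
            (6 * x ^ 2 + W.b₂ * x + W.b₄) * s1 ^ 2 * t1

lemma psi_eq_zero_iff (hP : P ≠ 0) (n : ℕ) : P.psi n = 0 ↔ n • P = 0 := by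
  obtain ⟨h₁, h₂⟩ := smul_eq_zero_or_mulFormula hP n
  exact ⟨fun h ↦ by_contra fun h' ↦ (h₂ h').1 h, h₁⟩

lemma eval_ΨSq_eq_zero_iff (hP : P ≠ 0) (n : ℕ) :
    (W.ΨSq n).eval P.xCoord = 0 ↔ n • P = 0 := by
  rw [← psi_sq_eq hP, sq_eq_zero_iff, psi_eq_zero_iff hP]

lemma xCoord_smul_mul_eval_ΨSq {n : ℕ} (h : n • P ≠ 0) :
    (n • P).xCoord * (W.ΨSq n).eval P.xCoord = (W.Φ n).eval P.xCoord := by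
  have hP : P ≠ 0 := by
    rintro rfl
    exact h (smul_zero n)
  have := ((smul_eq_zero_or_mulFormula hP n).2 h).2
  rw [eval_Φ hP, ← psi_sq_eq hP]
  linear_combination -this

end WeierstrassCurve.Affine.Point

/-! ### Changes of variables as group homomorphisms -/

namespace WeierstrassCurve.Affine.Point

variable {F : Type*} [Field F] {W : WeierstrassCurve F} (C : VariableChange F)

lemma equation_variableChange {x y : F} (h : W.toAffine.Equation x y) :
    (C • W).toAffine.Equation (C.u⁻¹ ^ 2 * (x - C.r))
      (C.u⁻¹ ^ 3 * (y - C.s * (x - C.r) - C.t)) := by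
  rw [equation_iff] at h ⊢
  simp only [variableChange_a₁, variableChange_a₂, variableChange_a₃, variableChange_a₄,
    variableChange_a₆]
  generalize (↑C.u⁻¹ : F) = v
  linear_combination v ^ 6 * h

lemma nonsingular_variableChange [W.IsElliptic] {x y : F} (h : W.toAffine.Nonsingular x y) :
    (C • W).toAffine.Nonsingular (C.u⁻¹ ^ 2 * (x - C.r))
      (C.u⁻¹ ^ 3 * (y - C.s * (x - C.r) - C.t)) :=
  equation_iff_nonsingular.mp (equation_variableChange C h.1)

/-- The function on points induced by a change of variables. -/
def variableChangeFun [W.IsElliptic] : W.toAffine.Point → (C • W).toAffine.Point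
  | 0 => 0
  | some _ _ h => some _ _ (nonsingular_variableChange C h)

lemma negY_variableChange (x y : F) : (C • W).toAffine.negY (C.u⁻¹ ^ 2 * (x - C.r))
      (C.u⁻¹ ^ 3 * (y - C.s * (x - C.r) - C.t)) =
    C.u⁻¹ ^ 3 * (W.toAffine.negY x y - C.s * (x - C.r) - C.t) := by
  simp only [negY, variableChange_a₁, variableChange_a₃]
  ring

lemma slope_variableChange [DecidableEq F] {x₁ y₁ x₂ y₂ : F}
    (h : ¬ (x₁ = x₂ ∧ y₁ = W.toAffine.negY x₂ y₂)) (h₁ : W.toAffine.Equation x₁ y₁)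
    (h₂ : W.toAffine.Equation x₂ y₂) :
    (C • W).toAffine.slope (C.u⁻¹ ^ 2 * (x₁ - C.r)) (C.u⁻¹ ^ 2 * (x₂ - C.r))
      (C.u⁻¹ ^ 3 * (y₁ - C.s * (x₁ - C.r) - C.t)) (C.u⁻¹ ^ 3 * (y₂ - C.s * (x₂ - C.r) - C.t)) =
    C.u⁻¹ * (W.toAffine.slope x₁ x₂ y₁ y₂ - C.s) := by
  have hu : (↑C.u⁻¹ : F) ≠ 0 := C.u⁻¹.ne_zero
  by_cases hx : x₁ = x₂
  · subst hx
    have hy : y₁ ≠ W.toAffine.negY x₁ y₂ := fun h' ↦ h ⟨rfl, h'⟩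
    obtain rfl := Y_eq_of_Y_ne h₁ h₂ rfl hy
    rw [slope_of_Y_ne rfl hy, slope_of_Y_ne rfl, negY_variableChange]
    · have hd : y₁ - W.toAffine.negY x₁ y₁ ≠ 0 := sub_ne_zero.mpr hy
      have hd' : (↑C.u⁻¹ : F) ^ 3 * (y₁ - C.s * (x₁ - C.r) - C.t) -
          C.u⁻¹ ^ 3 * (W.toAffine.negY x₁ y₁ - C.s * (x₁ - C.r) - C.t) =
          C.u⁻¹ ^ 3 * (y₁ - W.toAffine.negY x₁ y₁) := by ring
      rw [hd']
      simp only [variableChange_a₁, variableChange_a₂, variableChange_a₄]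
      generalize (↑C.u⁻¹ : F) = v at *
      rw [div_eq_iff (mul_ne_zero (pow_ne_zero 3 hu) hd)]
      have : v * ((3 * x₁ ^ 2 + 2 * W.a₂ * x₁ + W.a₄ - W.a₁ * y₁) / (y₁ - W.toAffine.negY x₁ y₁)) *
          (v ^ 3 * (y₁ - W.toAffine.negY x₁ y₁)) =
          v ^ 4 * (3 * x₁ ^ 2 + 2 * W.a₂ * x₁ + W.a₄ - W.a₁ * y₁) := by
        field_simp
      have hD : y₁ - W.toAffine.negY x₁ y₁ = 2 * y₁ + W.a₁ * x₁ + W.a₃ := by rw [negY]; ring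
      linear_combination -this + v ^ 4 * C.s * hD
    · rw [negY_variableChange]
      intro h'
      apply hy
      have := mul_left_cancel₀ (pow_ne_zero 3 hu) h'
      linear_combination this
  · rw [slope_of_X_ne hx, slope_of_X_ne]
    · have hd : x₁ - x₂ ≠ 0 := sub_ne_zero.mpr hx
      have hd' : (↑C.u⁻¹ : F) ^ 2 * (x₁ - C.r) - C.u⁻¹ ^ 2 * (x₂ - C.r) =
          C.u⁻¹ ^ 2 * (x₁ - x₂) := by ring
      rw [hd']
      generalize (↑C.u⁻¹ : F) = v at *
      field_simp
      ring
    · intro h'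
      apply hx
      have := mul_left_cancel₀ (pow_ne_zero 2 hu) h'
      linear_combination this

/-- The homomorphism on points induced by a change of variables. -/
noncomputable def variableChangeHom [W.IsElliptic] [DecidableEq F] :
    W.toAffine.Point →+ (C • W).toAffine.Point where
  toFun := variableChangeFun C
  map_zero' := rfl
  map_add' := by
    have hu : (↑C.u⁻¹ : F) ≠ 0 := C.u⁻¹.ne_zero
    rintro (_ | ⟨x₁, y₁, h₁⟩) (_ | ⟨x₂, y₂, h₂⟩)
    · rfl
    · rfl
    · rfl
    by_cases hxy : x₁ = x₂ ∧ y₁ = W.toAffine.negY x₂ y₂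
    · rw [add_of_Y_eq hxy.1 hxy.2]
      simp only [variableChangeFun]
      rw [add_of_Y_eq (by rw [hxy.1]) (by rw [negY_variableChange, hxy.1, hxy.2])]
    · rw [add_some hxy]
      simp only [variableChangeFun]
      rw [add_some]
      · simp only [some.injEq, slope_variableChange C hxy h₁.1 h₂.1]
        generalize W.toAffine.slope x₁ x₂ y₁ y₂ = l
        simp only [addX, addY, negAddY, negY, variableChange_a₁, variableChange_a₂,
          variableChange_a₃]
        constructor <;> ring
      · rw [negY_variableChange]
        rintro ⟨ha, hb⟩
        have ha := mul_left_cancel₀ (pow_ne_zero 2 hu) ha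
        have hb := mul_left_cancel₀ (pow_ne_zero 3 hu) hb
        have ha' : x₁ = x₂ := by linear_combination ha
        refine hxy ⟨ha', ?_⟩
        rw [ha'] at hb
        linear_combination hb

lemma variableChangeHom_injective [W.IsElliptic] [DecidableEq F] :
    Function.Injective (variableChangeHom (W := W) C) := by
  have hu : (↑C.u⁻¹ : F) ≠ 0 := C.u⁻¹.ne_zero
  rw [injective_iff_map_eq_zero]
  rintro (_ | ⟨x, y, h⟩) hP
  · rfl
  · exact absurd hP (some_ne_zero _)

lemma variableChangeHom_some [W.IsElliptic] [DecidableEq F] {x y : F}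
    (h : W.toAffine.Nonsingular x y) :
    variableChangeHom C (some x y h) = some _ _ (nonsingular_variableChange C h) := rfl

end WeierstrassCurve.Affine.Point

/-! ### Division polynomials of supersingular curves -/

namespace WeierstrassCurve

section Supersingular

open Polynomial

variable {k : Type*} [Field k]

lemma exists_point_of_isAlgClosed [IsAlgClosed k] (W : WeierstrassCurve k) [W.IsElliptic] (x : k) :
    ∃ P : W.toAffine.Point, P ≠ 0 ∧ P.xCoord = x := by
  obtain ⟨y, hy⟩ := IsAlgClosed.exists_root
    (X ^ 2 + C (W.a₁ * x + W.a₃) * X - C (x ^ 3 + W.a₂ * x ^ 2 + W.a₄ * x + W.a₆) : k[X]) (by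
      have : (X ^ 2 + C (W.a₁ * x + W.a₃) * X -
        C (x ^ 3 + W.a₂ * x ^ 2 + W.a₄ * x + W.a₆) : k[X]).degree = 2 := by compute_degree!
      rw [this]
      decide)
  have h : W.toAffine.Nonsingular x y := by
    rw [← Affine.equation_iff_nonsingular, Affine.equation_iff]
    simp [IsRoot] at hy
    linear_combination hy
  exact ⟨.some x y h, Affine.Point.some_ne_zero h, rfl⟩

lemma exists_eq_C_of_forall_eval_ne_zero {f : k[X]}
    (h : ∀ x : AlgebraicClosure k, aeval x f ≠ 0) : ∃ c : k, c ≠ 0 ∧ f = C c := by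
  have hd : f.degree = 0 := by
    by_contra hd
    obtain ⟨x, hx⟩ := IsAlgClosed.exists_aeval_eq_zero (AlgebraicClosure k) f hd
    exact h x hx
  rw [eq_C_of_degree_eq_zero hd] at h ⊢
  exact ⟨_, by simpa using h 0, rfl⟩

/-- Every element of the algebraic closure is the `x`-coordinate of a point, so a root would yield a
nonzero `p`-torsion point; a polynomial without roots is a nonzero constant. -/
lemma IsSupersingular.ΨSq_eq_C {W : WeierstrassCurve k} (hW : W.IsSupersingular) :
    ∃ c : k, c ≠ 0 ∧ W.ΨSq (ringChar k) = C c := by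
  classical
  obtain ⟨hE, h⟩ := hW
  refine exists_eq_C_of_forall_eval_ne_zero fun x hx ↦ ?_
  have : (W.baseChange (AlgebraicClosure k)).IsElliptic :=
    inferInstanceAs (W.map _).IsElliptic
  obtain ⟨P, hP, rfl⟩ := exists_point_of_isAlgClosed (W.baseChange (AlgebraicClosure k)) x
  refine hP (h P ?_)
  convert (Affine.Point.eval_ΨSq_eq_zero_iff hP (ringChar k)).mp ?_
  rw [← hx, ← eval_map_algebraMap, ← map_ΨSq]
  rfl

lemma IsSupersingular.preΨ_eq_C {W : WeierstrassCurve k} (hW : W.IsSupersingular)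
    (h2 : ¬ Even (ringChar k)) : ∃ c : k, c ≠ 0 ∧ W.preΨ (ringChar k) = C c := by
  obtain ⟨c, hc, h⟩ := hW.ΨSq_eq_C
  rw [ΨSq, if_neg (by exact_mod_cast h2), mul_one] at h
  have hd : (W.preΨ (ringChar k)).degree = 0 := by
    have := congrArg degree h
    rw [degree_C hc, degree_pow, nsmul_eq_mul] at this
    have h0 : W.preΨ (ringChar k) ≠ 0 := by
      intro h0
      rw [h0] at h
      exact hc (by simpa using h.symm)
    rw [degree_eq_natDegree h0] at this ⊢
    norm_cast at this ⊢
    omega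
  have h' := eq_C_of_degree_eq_zero hd
  refine ⟨_, fun h0 ↦ ?_, h'⟩
  rw [h0, map_zero] at h'
  rw [h'] at hd
  simp at hd

end Supersingular

end WeierstrassCurve

/-! ### Polynomials whose Newton polygon is one segment -/

section Valuation

open Polynomial

variable {F Γ : Type*} [Field F] [LinearOrderedCommGroupWithZero Γ] (v : Valuation F Γ)

variable {v} {g : F[X]} {N : ℕ} {x : F} {ϖ : Γ}

lemma Valuation.eval_le_one (h : ∀ i, v (g.coeff i) ≤ 1) (hx : v x ≤ 1) : v (g.eval x) ≤ 1 := by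
  rw [eval_eq_sum_range]
  refine v.map_sum_le fun i _ ↦ ?_
  rw [map_mul, map_pow]
  exact mul_le_one' (h i) (pow_le_one' hx i)

lemma Valuation.eval_eq_pow (hN : g.natDegree ≤ N) (h : ∀ i, v (g.coeff i) ≤ 1)
    (hg : v (g.coeff N) = 1) (hx : 1 < v x) : v (g.eval x) = v x ^ N := by
  rw [eval_eq_sum_range' (Nat.lt_succ_of_le hN), Finset.sum_range_succ]
  have hN' : v (g.coeff N * x ^ N) = v x ^ N := by rw [map_mul, map_pow, hg, one_mul]
  rw [Valuation.map_add_eq_of_lt_right, hN']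
  rw [hN']
  refine v.map_sum_lt (pow_ne_zero _ (zero_lt_one.trans hx).ne') fun i hi ↦ ?_
  rw [map_mul, map_pow]
  exact (mul_le_of_le_one_left' (h i)).trans_lt (pow_lt_pow_right₀ hx (Finset.mem_range.mp hi))

lemma Valuation.eval_eq_one_of_lt (hN : g.natDegree ≤ N) (h0 : v (g.coeff 0) = 1)
    (h : ∀ i ≠ 0, v (g.coeff i) ≤ ϖ) (hϖ : ϖ < 1) (hx : ϖ * v x ^ N < 1) : v (g.eval x) = 1 := by
  rw [eval_eq_sum_range' (Nat.lt_succ_of_le hN), Finset.sum_range_succ']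
  rw [pow_zero, mul_one, Valuation.map_add_eq_of_lt_right, h0]
  rw [h0]
  refine v.map_sum_lt one_ne_zero fun i hi ↦ ?_
  rw [map_mul, map_pow]
  refine (mul_le_mul_left (h _ i.succ_ne_zero) _).trans_lt ?_
  rcases le_total (v x) 1 with h1 | h1
  · exact (mul_le_of_le_one_right' (pow_le_one' h1 _)).trans_lt hϖ
  · refine lt_of_le_of_lt ?_ hx
    gcongr
    exact Finset.mem_range.mp hi

lemma one_lt_of_one_le_mul_pow {t : Γ} (hϖ : ϖ < 1) (ht : 1 ≤ ϖ * t ^ N) : 1 < t := by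
  by_contra h
  exact absurd ht (not_le.mpr ((mul_le_of_le_one_right' (pow_le_one' (not_lt.mp h) _)).trans_lt hϖ))

lemma Valuation.eval_le_of_le (hN : g.natDegree ≤ N) (h0 : v (g.coeff 0) = 1)
    (h : ∀ i ≠ 0, v (g.coeff i) ≤ ϖ) (hϖ : ϖ < 1) (hx : 1 ≤ ϖ * v x ^ N) :
    v (g.eval x) ≤ ϖ * v x ^ N := by
  have h1 := one_lt_of_one_le_mul_pow hϖ hx
  rw [eval_eq_sum_range' (Nat.lt_succ_of_le hN)]
  refine v.map_sum_le fun i hi ↦ ?_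
  rw [map_mul, map_pow]
  rcases eq_or_ne i 0 with rfl | hi0
  · simpa [h0] using hx
  · have := Finset.mem_range.mp hi
    have := h i hi0
    gcongr
    · exact h1.le
    · omega

/-- Below the threshold `ϖ * v x ^ N = 1` the constant term strictly dominates, above it the leading
term does; only at the threshold can the terms cancel. -/
lemma Valuation.mul_pow_eq_one_of_eval_eq_zero (hN : g.natDegree ≤ N)
    (h0 : v (g.coeff 0) = 1) (h : ∀ i ≠ 0, v (g.coeff i) ≤ ϖ) (hϖ : ϖ < 1)
    (hgN : v (g.coeff N) = ϖ) (hx : g.eval x = 0) : ϖ * v x ^ N = 1 := by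
  rcases lt_trichotomy (ϖ * v x ^ N) 1 with hlt | heq | hgt
  · have := eval_eq_one_of_lt hN h0 h hϖ hlt
    rw [hx, map_zero] at this
    exact absurd this zero_ne_one
  · exact heq
  · have h1 := one_lt_of_one_le_mul_pow hϖ hgt.le
    rw [eval_eq_sum_range' (Nat.lt_succ_of_le hN), Finset.sum_range_succ] at hx
    have hN' : v (g.coeff N * x ^ N) = ϖ * v x ^ N := by rw [map_mul, map_pow, hgN]
    have hne : ϖ * v x ^ N ≠ 0 := (zero_lt_one.trans hgt).ne'
    have hlt : v (∑ i ∈ Finset.range N, g.coeff i * x ^ i) < v (g.coeff N * x ^ N) := by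
      rw [hN']
      refine v.map_sum_lt hne fun i hi ↦ ?_
      rw [map_mul, map_pow]
      rcases eq_or_ne i 0 with rfl | hi0
      · simpa [h0] using hgt
      · refine (mul_le_mul_left (h i hi0) _).trans_lt ?_
        have hp : 0 < ϖ := zero_lt_iff.mpr (left_ne_zero_of_mul hne)
        have := pow_lt_pow_right₀ h1 (Finset.mem_range.mp hi)
        exact mul_lt_mul_of_pos_left this hp
    have := Valuation.map_add_eq_of_lt_right v hlt
    rw [hx, map_zero, hN'] at this
    exact absurd this.symm hne

end Valuation

/-! ### Comparing a place above `p` with the `p`-adic norm on rationals -/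

section PadicRat

variable {p : ℕ} [Fact p.Prime] {L Γ : Type*} [Field L]
  [LinearOrderedCommGroupWithZero Γ] {v : Valuation L Γ}

lemma Valuation.map_intCast_le_one (v : Valuation L Γ) (n : ℤ) : v n ≤ 1 := by
  have h : ∀ n : ℕ, v n ≤ 1 := fun n ↦ by
    induction n with
    | zero => simp
    | succ n ih => simpa using (v.map_add_le ih v.map_one.le)
  obtain ⟨n, rfl | rfl⟩ := n.eq_nat_or_neg
  · simpa using h n
  · simpa using h n

lemma Valuation.map_intCast_eq_one {p : ℕ} (hp : v p < 1) {n : ℤ} (hn : IsCoprime n p) :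
    v n = 1 := by
  refine (v.map_intCast_le_one n).antisymm (not_lt.mp fun hlt ↦ ?_)
  obtain ⟨a, b, hab⟩ := hn
  have h : v ((a * n + b * p : ℤ) : L) = 1 := by rw [hab]; simp
  refine h.not_lt ?_
  push_cast
  refine v.map_add_lt ?_ ?_ <;> rw [map_mul]
  · exact (mul_le_of_le_one_left' (v.map_intCast_le_one a)).trans_lt hlt
  · exact (mul_le_of_le_one_left' (v.map_intCast_le_one b)).trans_lt hp

variable [Algebra ℚ L]

lemma Valuation.map_rat_le_one (hp : v p < 1) {q : ℚ} (hq : ‖(q : ℚ_[p])‖ ≤ 1) :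
    v (algebraMap ℚ L q) ≤ 1 := by
  have hden : v (q.den : L) = 1 := by
    have h := PadicInt.isUnit_iff.mp (PadicInt.isUnit_den q hq)
    have : IsCoprime (q.den : ℤ) p := by
      rw [Nat.isCoprime_iff_coprime, Nat.coprime_comm, (Fact.out : p.Prime).coprime_iff_not_dvd]
      intro hd
      have := (PadicInt.norm_int_lt_one_iff_dvd (p := p) q.den).mpr (by exact_mod_cast hd)
      simp [h] at this
    simpa using Valuation.map_intCast_eq_one hp this
  have : algebraMap ℚ L q * q.den = q.num := by
    rw [← map_natCast (algebraMap ℚ L), ← map_intCast (algebraMap ℚ L), ← map_mul,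
      Rat.mul_den_eq_num]
  have h := congrArg v this
  rw [map_mul, hden, mul_one] at h
  exact h ▸ v.map_intCast_le_one _

lemma Valuation.map_rat_le (hp : v p < 1) {q : ℚ} (hq : ‖(q : ℚ_[p])‖ < 1) :
    v (algebraMap ℚ L q) ≤ v p := by
  have hp0 : (p : ℚ) ≠ 0 := by exact_mod_cast (Fact.out : p.Prime).ne_zero
  have h : v (algebraMap ℚ L (q / p)) ≤ 1 := by
    refine Valuation.map_rat_le_one hp ?_
    obtain ⟨z, hz⟩ := (PadicInt.norm_lt_one_iff_dvd (⟨q, hq.le⟩ : ℤ_[p])).mp hq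
    have h2 : (q : ℚ_[p]) = p * z := by simpa using congrArg ((↑) : ℤ_[p] → ℚ_[p]) hz
    have h3 : ((q / p : ℚ) : ℚ_[p]) = z := by
      push_cast
      rw [h2, mul_div_cancel_left₀]
      exact_mod_cast hp0
    rw [h3]
    exact z.norm_le_one
  have h4 : algebraMap ℚ L q = p * algebraMap ℚ L (q / p) := by
    rw [← map_natCast (algebraMap ℚ L), ← map_mul, mul_div_cancel₀ _ hp0]
  rw [h4, map_mul]
  exact mul_le_of_le_one_right' h

lemma Valuation.map_rat_eq_one (hp : v p < 1) {q : ℚ} (hq : ‖(q : ℚ_[p])‖ = 1) :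
    v (algebraMap ℚ L q) = 1 := by
  refine (Valuation.map_rat_le_one hp hq.le).antisymm ?_
  have h := Valuation.map_rat_le_one (q := q⁻¹) (L := L) (p := p) hp
    (by rw [Rat.cast_inv, norm_inv, hq, inv_one])
  rw [map_inv₀, map_inv₀] at h
  have h0 : v (algebraMap ℚ L q) ≠ 0 := by
    rw [Ne, v.zero_iff, map_eq_zero]
    rintro rfl
    simp at hq
  exact (inv_le_one₀ (zero_lt_iff.mpr h0)).mp h

end PadicRat

/-! ### Valuations of `p`-power torsion points at a supersingular prime -/

namespace WeierstrassCurve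

open Polynomial

/-- When `x` has a pole, `x³` dominates the right side. This forces `v x < v y`, since otherwise the
left side would be at most `v x ^ 2`; hence `y²` dominates the left side. -/
lemma Affine.Point.valuation_yCoord_sq {L Γ : Type*} [Field L] [LinearOrderedCommGroupWithZero Γ]
    {v : Valuation L Γ} (W : WeierstrassCurve L) (h : v W.a₁ ≤ 1 ∧ v W.a₂ ≤ 1 ∧
      v W.a₃ ≤ 1 ∧ v W.a₄ ≤ 1 ∧ v W.a₆ ≤ 1) {P : W.toAffine.Point} (hP : P ≠ 0)
    (hx : 1 < v P.xCoord) : v P.yCoord ^ 2 = v P.xCoord ^ 3 := by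
  obtain ⟨h₁, h₂, h₃, h₄, h₆⟩ := h
  have heq := equation_of_ne_zero hP
  set x := P.xCoord
  set y := P.yCoord
  have hx0 : v x ≠ 0 := (zero_lt_one.trans hx).ne'
  have heq' : y * (y + (W.a₁ * x + W.a₃)) = x ^ 3 + (W.a₂ * x ^ 2 + (W.a₄ * x + W.a₆)) := by
    linear_combination heq
  have hl : v (W.a₁ * x + W.a₃) ≤ v x := by
    refine v.map_add_le ?_ (h₃.trans hx.le)
    rw [map_mul]
    exact mul_le_of_le_one_left' h₁
  have hr : v (W.a₂ * x ^ 2 + (W.a₄ * x + W.a₆)) ≤ v x ^ 2 := by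
    refine v.map_add_le ?_ (v.map_add_le ?_ (h₆.trans (one_le_pow_of_one_le' hx.le 2)))
    · rw [map_mul, map_pow]
      exact mul_le_of_le_one_left' h₂
    · rw [map_mul]
      exact (mul_le_of_le_one_left' h₄).trans (le_self_pow hx.le two_ne_zero)
  have hr' : v (x ^ 3 + (W.a₂ * x ^ 2 + (W.a₄ * x + W.a₆))) = v x ^ 3 := by
    rw [Valuation.map_add_eq_of_lt_left, map_pow]
    rw [map_pow]
    exact hr.trans_lt (pow_lt_pow_right₀ hx (by norm_num))
  have hy : v x < v y := by
    by_contra hy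
    have hy := not_lt.mp hy
    have : v x ^ 3 ≤ v x ^ 2 := by
      rw [← hr', ← heq', map_mul, pow_two]
      exact mul_le_mul' hy (v.map_add_le hy hl)
    exact this.not_gt (pow_lt_pow_right₀ hx (by norm_num))
  rw [← hr', ← heq', map_mul, Valuation.map_add_eq_of_lt_left _ (hl.trans_lt hy), pow_two]

/-- A rational Weierstrass equation is a supersingular model at `p` if it is `p`-integral and its
reduction modulo `p` is a supersingular elliptic curve. -/
def IsSupersingularModelAt (E : WeierstrassCurve ℚ) (p : ℕ) [Fact p.Prime] : Prop :=
  ∃ W : WeierstrassCurve ℤ_[p], W.map (algebraMap ℤ_[p] ℚ_[p]) = E.map (algebraMap ℚ ℚ_[p]) ∧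
    (W.map (IsLocalRing.residue ℤ_[p])).IsSupersingular

lemma coeff_Ψ₂Sq_low {R : Type*} [CommRing R] (W : WeierstrassCurve R) :
    W.Ψ₂Sq.coeff 0 = W.b₆ ∧ W.Ψ₂Sq.coeff 1 = 2 * W.b₄ ∧ W.Ψ₂Sq.coeff 2 = W.b₂ := by
  simp only [Ψ₂Sq, coeff_add, coeff_C_mul, coeff_X_pow, coeff_X, coeff_C]
  norm_num

lemma ringChar_residueField (p : ℕ) [Fact p.Prime] :
    ringChar (IsLocalRing.ResidueField ℤ_[p]) = p := by
  have : CharP (IsLocalRing.ResidueField ℤ_[p]) p :=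
    charP_of_injective_ringHom (f := PadicInt.residueField (p := p).symm.toRingHom)
      (PadicInt.residueField (p := p).symm.injective) p
  exact ringChar.eq _ p

variable {p : ℕ} [Fact p.Prime] {L Γ : Type*} [Field L] [Algebra ℚ L]
  [LinearOrderedCommGroupWithZero Γ] {v : Valuation L Γ}

lemma norm_lt_one_of_residue_eq_zero {q : ℚ} {z : ℤ_[p]} (h : (z : ℚ_[p]) = q)
    (hz : IsLocalRing.residue ℤ_[p] z = 0) : ‖(q : ℚ_[p])‖ < 1 := by
  rw [IsLocalRing.residue_eq_zero_iff, IsLocalRing.mem_maximalIdeal, PadicInt.mem_nonunits] at hz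
  rwa [← h]

lemma norm_eq_one_of_residue_ne_zero {q : ℚ} {z : ℤ_[p]} (h : (z : ℚ_[p]) = q)
    (hz : IsLocalRing.residue ℤ_[p] z ≠ 0) : ‖(q : ℚ_[p])‖ = 1 := by
  rw [Ne, IsLocalRing.residue_eq_zero_iff, IsLocalRing.mem_maximalIdeal, PadicInt.mem_nonunits]
    at hz
  rw [← h]
  exact z.norm_le_one.antisymm (not_lt.mp hz)

section Coeff

variable {f : ℤ_[p][X]} {g : ℚ[X]}
  (h : f.map (algebraMap ℤ_[p] ℚ_[p]) = g.map (algebraMap ℚ ℚ_[p]))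
include h

lemma coeff_eq_of_map_eq (i : ℕ) : (f.coeff i : ℚ_[p]) = (g.coeff i : ℚ) := by
  simpa using congrArg (fun q ↦ q.coeff i) h

lemma valuation_coeff_le_one (hp : v p < 1) (i : ℕ) :
    v ((g.map (algebraMap ℚ L)).coeff i) ≤ 1 := by
  rw [coeff_map]
  refine Valuation.map_rat_le_one hp ?_
  rw [← coeff_eq_of_map_eq h]
  exact (f.coeff i).norm_le_one

lemma valuation_coeff_of_residue_eq_C (hp : v p < 1) {c : IsLocalRing.ResidueField ℤ_[p]}
    (hc : c ≠ 0) (hf : f.map (IsLocalRing.residue ℤ_[p]) = C c) :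
    v ((g.map (algebraMap ℚ L)).coeff 0) = 1 ∧
      ∀ i ≠ 0, v ((g.map (algebraMap ℚ L)).coeff i) ≤ v p := by
  have hr (i : ℕ) := congrArg (fun q ↦ q.coeff i) hf
  simp only [coeff_map] at hr ⊢
  constructor
  · refine Valuation.map_rat_eq_one hp (norm_eq_one_of_residue_ne_zero (coeff_eq_of_map_eq h 0) ?_)
    rwa [hr, coeff_C_zero]
  · intro i hi
    refine Valuation.map_rat_le hp (norm_lt_one_of_residue_eq_zero (coeff_eq_of_map_eq h i) ?_)
    rw [hr, coeff_C_of_ne_zero hi]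

end Coeff

/-- The size of the values of the division polynomial `ΨSq p` at a supersingular prime `p`. -/
lemma IsSupersingularModelAt.valuation_ΨSq {E : WeierstrassCurve ℚ}
    (hE : E.IsSupersingularModelAt p) (hp : v p < 1) (x : L) :
    (v p ^ 2 * v x ^ (p ^ 2 - 1) < 1 → v (((E⁄L).ΨSq p).eval x) = 1) ∧
    (1 ≤ v p ^ 2 * v x ^ (p ^ 2 - 1) →
      v (((E⁄L).ΨSq p).eval x) ≤ v p ^ 2 * v x ^ (p ^ 2 - 1)) ∧
    (((E⁄L).ΨSq p).eval x = 0 → v p ^ 2 * v x ^ (p ^ 2 - 1) = 1) := by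
  obtain ⟨W, hWE, hW⟩ := hE
  rcases (Fact.out : p.Prime).eq_two_or_odd' with rfl | hodd
  -- For `p = 2` the cubic `Ψ₂Sq` is used directly, and its nonconstant coefficients must be bounded
  -- by `v 2 ^ 2`, whereas reduction alone gives `v 2`. The gain comes from `b₂ ≡ a₁²` modulo `2`:
  -- constancy of the reduction forces `2` to divide `a₁`.
  · obtain ⟨c, hc, hcW⟩ := hW.ΨSq_eq_C
    have h2 : (2 : IsLocalRing.ResidueField ℤ_[2]) = 0 := by
      have := ringChar.Nat.cast_ringChar (R := IsLocalRing.ResidueField ℤ_[2])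
      rwa [ringChar_residueField] at this
    rw [ringChar_residueField, Nat.cast_ofNat, ΨSq_two] at hcW
    have hb₂ : IsLocalRing.residue ℤ_[2] W.a₁ = 0 := by
      have := congrArg (fun q ↦ q.coeff 2) hcW
      simp only [(coeff_Ψ₂Sq_low _).2.2, coeff_C_of_ne_zero two_ne_zero, b₂, map_a₁, map_a₂] at this
      refine pow_eq_zero_iff two_ne_zero |>.mp (?_ : IsLocalRing.residue ℤ_[2] W.a₁ ^ 2 = 0)
      linear_combination this - 2 * h2 * IsLocalRing.residue ℤ_[2] W.a₂
    have hb₆ : IsLocalRing.residue ℤ_[2] W.b₆ ≠ 0 := by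
      have := congrArg (fun q ↦ q.coeff 0) hcW
      simp only [(coeff_Ψ₂Sq_low _).1, coeff_C_zero, map_b₆] at this
      rwa [this]
    have ha (f : WeierstrassCurve ℤ_[2] → ℤ_[2]) (g : WeierstrassCurve ℚ → ℚ)
        (f' : WeierstrassCurve ℚ_[2] → ℚ_[2]) (hf : ∀ W, f' (W.map (algebraMap _ _)) = f W)
        (hg : ∀ W, f' (W.map (algebraMap _ _)) = g W) : (f W : ℚ_[2]) = g E := by
      rw [← hf, hWE, hg]
    have hle : ∀ {q : ℚ} {z : ℤ_[2]}, (z : ℚ_[2]) = q → v (algebraMap ℚ L q) ≤ 1 := fun {q z} h ↦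
      Valuation.map_rat_le_one (p := 2) hp (h ▸ z.norm_le_one)
    have ha₁ : v (algebraMap ℚ L E.a₁) ≤ v 2 := Valuation.map_rat_le (p := 2) hp
      (norm_lt_one_of_residue_eq_zero (ha a₁ a₁ a₁ (fun _ ↦ rfl) (fun _ ↦ by simp)) hb₂)
    have ha₂ := hle (ha a₂ a₂ a₂ (fun _ ↦ rfl) (fun _ ↦ by simp))
    have ha₃ := hle (ha a₃ a₃ a₃ (fun _ ↦ rfl) (fun _ ↦ by simp))
    have ha₄ := hle (ha a₄ a₄ a₄ (fun _ ↦ rfl) (fun _ ↦ by simp))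
    have hb₆' : v (algebraMap ℚ L E.b₆) = 1 := Valuation.map_rat_eq_one (p := 2) hp
      (norm_eq_one_of_residue_ne_zero
        (ha b₆ b₆ b₆ (fun _ ↦ by rw [map_b₆]; rfl) (fun _ ↦ by rw [map_b₆]; simp)) hb₆)
    have hp' : v (2 : L) < 1 := by simpa using hp
    have h4 : v (4 : L) = v 2 ^ 2 := by rw [← map_pow]; norm_num
    have h21 : v (2 : L) ^ 2 < 1 := pow_lt_one' hp' two_ne_zero
    have hdeg : (E⁄L).Ψ₂Sq.natDegree ≤ 3 := natDegree_Ψ₂Sq_le _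
    have h0 : v ((E⁄L).Ψ₂Sq.coeff 0) = 1 := by
      rwa [(coeff_Ψ₂Sq_low _).1, baseChange, map_b₆]
    have h : ∀ i ≠ 0, v ((E⁄L).Ψ₂Sq.coeff i) ≤ v 2 ^ 2 := by
      intro i hi
      obtain hi' | hi' := lt_or_ge 3 i
      · rw [coeff_eq_zero_of_natDegree_lt (hdeg.trans_lt hi'), map_zero]
        exact zero_le
      have hA : v (4 * algebraMap ℚ L E.a₂) ≤ v 2 ^ 2 := by
        rw [map_mul, h4]; exact mul_le_of_le_one_right' ha₂
      interval_cases i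
      · exact absurd rfl hi
      · have : (E⁄L).Ψ₂Sq.coeff 1 = 4 * algebraMap ℚ L E.a₄ +
            2 * (algebraMap ℚ L E.a₁ * algebraMap ℚ L E.a₃) := by
          rw [(coeff_Ψ₂Sq_low _).2.1, baseChange, map_b₄, b₄]
          simp only [map_add, map_mul, map_ofNat]
          ring
        rw [this]
        refine v.map_add_le ?_ ?_
        · rw [map_mul, h4]; exact mul_le_of_le_one_right' ha₄
        · rw [map_mul, map_mul, pow_two]
          exact mul_le_mul_right ((mul_le_of_le_one_right' ha₃).trans ha₁) _
      · have : (E⁄L).Ψ₂Sq.coeff 2 = algebraMap ℚ L E.a₁ ^ 2 + 4 * algebraMap ℚ L E.a₂ := by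
          rw [(coeff_Ψ₂Sq_low _).2.2, baseChange, map_b₂, b₂]
          simp only [map_add, map_mul, map_ofNat, map_pow]
        rw [this]
        refine v.map_add_le ?_ hA
        rw [map_pow]
        exact pow_le_pow_left' ha₁ 2
      · rw [coeff_Ψ₂Sq, h4]
    simp only [Nat.cast_ofNat, ΨSq_two]
    exact ⟨Valuation.eval_eq_one_of_lt hdeg h0 h h21, Valuation.eval_le_of_le hdeg h0 h h21,
      Valuation.mul_pow_eq_one_of_eval_eq_zero hdeg h0 h h21 (h4 ▸ congrArg v (coeff_Ψ₂Sq _))⟩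
  · have hodd' : ¬ Even (p : ℤ) := by simpa using hodd
    obtain ⟨c, hc, hcW⟩ := hW.preΨ_eq_C (by rwa [ringChar_residueField, Nat.not_even_iff_odd])
    rw [ringChar_residueField, map_preΨ] at hcW
    have hWE' : (W.preΨ p).map (algebraMap ℤ_[p] ℚ_[p]) = (E.preΨ p).map (algebraMap ℚ ℚ_[p]) := by
      rw [← map_preΨ, hWE, map_preΨ]
    obtain ⟨h0, h⟩ := valuation_coeff_of_residue_eq_C (v := v) hWE' hp hc hcW
    rw [← map_preΨ] at h0 h
    have hN : ((p : ℤ).natAbs ^ 2 - if Even (p : ℤ) then 4 else 1) / 2 = (p ^ 2 - 1) / 2 := by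
      simp [hodd']
    have hdeg := hN ▸ (E⁄L).natDegree_preΨ_le p
    have hcoeff := (E⁄L).coeff_preΨ p
    rw [hN, if_neg hodd'] at hcoeff
    -- For odd `p`, `ΨSq p` is the square of `preΨ p`, which has leading coefficient `p` and degree
    -- `(p ^ 2 - 1) / 2`; the Newton polygon argument applies to `preΨ p`.
    have hsq : v p ^ 2 * v x ^ (p ^ 2 - 1) = (v p * v x ^ ((p ^ 2 - 1) / 2)) ^ 2 := by
      rw [mul_pow, ← pow_mul, Nat.div_mul_cancel]
      have : Odd (p ^ 2) := hodd.pow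
      rw [← even_iff_two_dvd]
      exact Nat.Odd.sub_odd this odd_one
    have hΨ : ((E⁄L).ΨSq p).eval x = ((E⁄L).preΨ p).eval x ^ 2 := by
      rw [ΨSq, if_neg hodd', mul_one, eval_pow]
    rw [hsq, hΨ, map_pow]
    refine ⟨fun hlt ↦ ?_, fun hle ↦ ?_, fun h0' ↦ ?_⟩
    · rw [pow_lt_one_iff two_ne_zero] at hlt
      rw [Valuation.eval_eq_one_of_lt hdeg h0 h hp hlt, one_pow]
    · rw [one_le_pow_iff two_ne_zero] at hle
      exact pow_le_pow_left' (Valuation.eval_le_of_le hdeg h0 h hp hle) 2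
    · rw [Valuation.mul_pow_eq_one_of_eval_eq_zero hdeg h0 h hp (by rw [hcoeff]; simp)
        (pow_eq_zero_iff two_ne_zero |>.mp h0'), one_pow]

lemma IsSupersingularModelAt.valuation_coeff_Φ_le_one {E : WeierstrassCurve ℚ}
    (hE : E.IsSupersingularModelAt p) (hp : v p < 1) (n : ℤ) (i : ℕ) :
    v (((E⁄L).Φ n).coeff i) ≤ 1 := by
  obtain ⟨W, hWE, -⟩ := hE
  rw [baseChange, map_Φ]
  exact valuation_coeff_le_one (f := W.Φ n) (by rw [← map_Φ, hWE, map_Φ]) hp i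

lemma IsSupersingularModelAt.valuation_coeff_ΨSq_le_one {E : WeierstrassCurve ℚ}
    (hE : E.IsSupersingularModelAt p) (hp : v p < 1) (n : ℤ) (i : ℕ) :
    v (((E⁄L).ΨSq n).coeff i) ≤ 1 := by
  obtain ⟨W, hWE, -⟩ := hE
  rw [baseChange, map_ΨSq]
  exact valuation_coeff_le_one (f := W.ΨSq n) (by rw [← map_ΨSq, hWE, map_ΨSq]) hp i

/-- The coefficients of a supersingular model are integral. -/
lemma IsSupersingularModelAt.valuation_a_le_one {E : WeierstrassCurve ℚ}
    (hE : E.IsSupersingularModelAt p) (hp : v p < 1) : v (E⁄L).a₁ ≤ 1 ∧ v (E⁄L).a₂ ≤ 1 ∧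
      v (E⁄L).a₃ ≤ 1 ∧ v (E⁄L).a₄ ≤ 1 ∧ v (E⁄L).a₆ ≤ 1 := by
  obtain ⟨W, hWE, -⟩ := hE
  have h {q : ℚ} {z : ℤ_[p]} (hqz : (z : ℚ_[p]) = algebraMap ℚ ℚ_[p] q) :
      v (algebraMap ℚ L q) ≤ 1 :=
    Valuation.map_rat_le_one (p := p) hp (by
      rw [← eq_ratCast (algebraMap ℚ ℚ_[p]), ← hqz]
      exact z.norm_le_one)
  exact ⟨h (z := W.a₁) (congrArg a₁ hWE), h (z := W.a₂) (congrArg a₂ hWE),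
    h (z := W.a₃) (congrArg a₃ hWE), h (z := W.a₄) (congrArg a₄ hWE),
    h (z := W.a₆) (congrArg a₆ hWE)⟩

lemma IsSupersingularModelAt.valuation_Δ {E : WeierstrassCurve ℚ}
    (hE : E.IsSupersingularModelAt p) (hp : v p < 1) : v (E⁄L).Δ = 1 := by
  obtain ⟨W, hWE, hW⟩ := hE
  have h : (W.Δ : ℚ_[p]) = E.Δ := by
    have := congrArg Δ hWE
    rwa [map_Δ, map_Δ, eq_ratCast] at this
  rw [baseChange, map_Δ]
  refine Valuation.map_rat_eq_one hp (norm_eq_one_of_residue_ne_zero h ?_)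
  rw [← map_Δ]
  exact hW.1.isUnit.ne_zero

open Affine.Point

variable [DecidableEq L]

/-- In `x(pP) = Φₚ / ΨSqₚ` the denominator is a unit and the monic integral numerator is dominated
by its leading term. At or above the threshold for `ΨSqₚ` one would get `v x(P) ≤ v p ^ 2 * v x(pP)
≤ 1`, contradicting the pole of `x(P)` there. The free exponent `a` fits the inductive hypothesis
for points of higher order. -/
lemma IsSupersingularModelAt.valuation_xCoord_smul {E : WeierstrassCurve ℚ}
    (hE : E.IsSupersingularModelAt p) (hp : v p < 1) {P : (E⁄L).toAffine.Point} (hP : p • P ≠ 0)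
    {a : ℕ} (ha : p ^ 2 - 1 ≤ a) (h : v p ^ 2 * v (p • P).xCoord ^ a = 1) :
    v (p • P).xCoord = v P.xCoord ^ (p ^ 2) := by
  have hP0 : P ≠ 0 := fun h ↦ hP (by rw [h, smul_zero])
  obtain ⟨hA, hB, -⟩ := hE.valuation_ΨSq hp P.xCoord
  have hx := congrArg v (xCoord_smul_mul_eval_ΨSq hP)
  rw [map_mul] at hx
  have hp2 : v (p : L) ^ 2 < 1 := pow_lt_one' hp two_ne_zero
  have ht : 1 < v (p • P).xCoord := one_lt_of_one_le_mul_pow hp2 h.ge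
  have hle : v p ^ 2 * v (p • P).xCoord ^ (p ^ 2 - 1) ≤ 1 := by
    rw [← h]
    gcongr
    exact ht.le
  have hΦ (h1 : 1 < v P.xCoord) : v (((E⁄L).Φ p).eval P.xCoord) = v P.xCoord ^ (p ^ 2) :=
    Valuation.eval_eq_pow (natDegree_Φ_le _ p) (hE.valuation_coeff_Φ_le_one hp p)
      (by
      have := coeff_Φ (E⁄L) p
      rw [Int.natAbs_natCast] at this
      rw [this, map_one]) h1
  have hpos : 0 < v (p • P).xCoord := zero_lt_one.trans ht
  rcases lt_or_ge (v p ^ 2 * v P.xCoord ^ (p ^ 2 - 1)) 1 with hlt | hge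
  · rw [hA hlt, mul_one] at hx
    have h1 : 1 < v P.xCoord := by
      by_contra h1
      rw [hx] at ht
      exact ht.not_ge (Valuation.eval_le_one (hE.valuation_coeff_Φ_le_one hp p) (not_lt.mp h1))
    rw [hx, ← hΦ h1]
  · have h1 := one_lt_of_one_le_mul_pow hp2 hge
    have hpos1 : 0 < v P.xCoord := zero_lt_one.trans h1
    rw [hΦ h1] at hx
    have h3 : v P.xCoord ^ (p ^ 2) ≤
        v (p • P).xCoord * (v p ^ 2 * v P.xCoord ^ (p ^ 2 - 1)) := by
      rw [← hx]
      gcongr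
      exact hB hge
    have h4 : p ^ 2 - 1 ≠ 0 := by
      have := (Fact.out : p.Prime).two_le
      have : 2 ^ 2 ≤ p ^ 2 := Nat.pow_le_pow_left this 2
      omega
    have h5 : v P.xCoord ≤ v (p • P).xCoord * v p ^ 2 := by
      rw [← mul_assoc, show p ^ 2 = (p ^ 2 - 1) + 1 by omega, pow_succ', Nat.add_sub_cancel] at h3
      exact le_of_mul_le_mul_right h3 (pow_pos hpos1 _)
    have h6 : v (p • P).xCoord ≤ v (p • P).xCoord ^ (p ^ 2 - 1) := le_self_pow ht.le h4
    refine absurd h1 (not_lt.mpr (h5.trans (le_trans ?_ hle)))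
    rw [mul_comm]
    gcongr

/-- At a place above a supersingular prime `p`, the valuation of the `x`-coordinate of a point of
order `p ^ (n + 1)` is determined by the valuation of `p`. -/
lemma IsSupersingularModelAt.valuation_xCoord_pow {E : WeierstrassCurve ℚ}
    (hE : E.IsSupersingularModelAt p) (hp : v p < 1) (n : ℕ) {P : (E⁄L).toAffine.Point}
    (hP : addOrderOf P = p ^ (n + 1)) :
    v p ^ 2 * v P.xCoord ^ ((p ^ 2 - 1) * p ^ (2 * n)) = 1 := by
  have hpp : p.Prime := Fact.out
  induction n generalizing P with
  | zero =>
    have hP0 : P ≠ 0 := by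
      rintro rfl
      simp [hpp.ne_one.symm] at hP
    simpa using (hE.valuation_ΨSq hp P.xCoord).2.2
      ((eval_ΨSq_eq_zero_iff hP0 p).mpr (by rw [← addOrderOf_dvd_iff_nsmul_eq_zero, hP]; simp))
  | succ n ih =>
    have hord : addOrderOf (p • P) = p ^ (n + 1) := by
      rw [addOrderOf_nsmul' P hpp.ne_zero, hP, Nat.gcd_eq_right (dvd_pow_self _ (by omega)),
        pow_succ, Nat.mul_div_cancel _ hpp.pos]
    have hpP : p • P ≠ 0 := by
      intro h0
      rw [h0, addOrderOf_zero] at hord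
      exact (Nat.one_lt_pow (by omega) hpp.one_lt).ne hord
    have h := ih hord
    rw [hE.valuation_xCoord_smul hp hpP (Nat.le_mul_of_pos_right _ (by positivity [hpp.pos])) h,
      ← pow_mul] at h
    rw [← h]
    ring_nf

/-- At a place above a supersingular prime `p`, a point of order `p ^ (n + 1)` produces a root of
the valuation of `p` of order `p ^ (2n + 2) - p ^ (2n)`. -/
theorem IsSupersingularModelAt.exists_valuation_pow {E : WeierstrassCurve ℚ}
    (hE : E.IsSupersingularModelAt p) (hp : v p < 1) (n : ℕ) {P : (E⁄L).toAffine.Point}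
    (hP : addOrderOf P = p ^ (n + 1)) :
    ∃ z : L, v p = v z ^ (p ^ (2 * (n + 1)) - p ^ (2 * (n + 1) - 2)) := by
  have h := hE.valuation_xCoord_pow hp n hP
  have hP0 : P ≠ 0 := by
    rintro rfl
    rw [addOrderOf_zero] at hP
    exact (Nat.one_lt_pow (by omega) (Fact.out : p.Prime).one_lt).ne hP
  have hx := one_lt_of_one_le_mul_pow (pow_lt_one' hp two_ne_zero) h.ge
  have hx0 : v P.xCoord ≠ 0 := (zero_lt_one.trans hx).ne'
  have hy := valuation_yCoord_sq (E⁄L) (hE.valuation_a_le_one hp) hP0 hx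
  -- Replacing `x` by the square of `y / x` lets the square on `v p ^ 2` be cancelled; `x` alone
  -- only exhibits `v p ^ 2` as a power.
  have hs : v (P.yCoord / P.xCoord) ^ 2 = v P.xCoord := by
    rw [map_div₀, div_pow, hy, pow_succ' _ 2, mul_div_cancel_right₀ _ (pow_ne_zero _ hx0)]
  refine ⟨(P.yCoord / P.xCoord)⁻¹, ?_⟩
  rw [← hs, ← pow_mul, mul_comm 2, pow_mul, ← mul_pow] at h
  have h' := (pow_eq_one_iff.mp h).resolve_right two_ne_zero
  have he : p ^ (2 * (n + 1)) - p ^ (2 * (n + 1) - 2) = (p ^ 2 - 1) * p ^ (2 * n) := by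
    rw [Nat.sub_mul, one_mul, ← pow_add]
    congr 2
    ring
  rw [map_inv₀, inv_pow, he, eq_inv_of_mul_eq_one_left h']

end WeierstrassCurve

/-! ### Reduction and torsion of order prime to `p` -/

namespace WeierstrassCurve

open Polynomial

section Reduction

variable {F Γ : Type*} [Field F] [LinearOrderedCommGroupWithZero Γ] {v : Valuation F Γ}

lemma _root_.Valuation.isUnit_valuationSubring_iff {x : v.valuationSubring} :
    IsUnit x ↔ v x = 1 := by
  have h := (Valuation.integer.integers v).isUnit_iff_valuation_eq_one (x := ⟨x, x.2⟩)
  exact h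

lemma _root_.Valuation.residue_eq_zero_iff {x : v.valuationSubring} :
    IsLocalRing.residue v.valuationSubring x = 0 ↔ v x < 1 := by
  rw [IsLocalRing.residue_eq_zero_iff, IsLocalRing.mem_maximalIdeal, mem_nonunits_iff,
    Valuation.isUnit_valuationSubring_iff]
  exact ⟨fun h ↦ lt_of_le_of_ne x.2 h, fun h ↦ h.ne⟩

variable {W : WeierstrassCurve F} (h : v W.a₁ ≤ 1 ∧ v W.a₂ ≤ 1 ∧
      v W.a₃ ≤ 1 ∧ v W.a₄ ≤ 1 ∧ v W.a₆ ≤ 1)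
include h

/-- The discriminant is a unit, so the reduced curve is nonsingular; as the `Y`-derivative reduces
to zero, the `X`-derivative cannot. -/
lemma valuation_partialDeriv_eq_one (hΔ : v W.Δ = 1) {x y : F} (hx : v x ≤ 1) (hy : v y ≤ 1)
    (hxy : W.toAffine.Equation x y) (hY : v (2 * y + W.a₁ * x + W.a₃) < 1) :
    v (3 * x ^ 2 + 2 * W.a₂ * x + W.a₄ - W.a₁ * y) = 1 := by
  obtain ⟨h₁, h₂, h₃, h₄, h₆⟩ := h
  let A := v.valuationSubring
  let W₀ : WeierstrassCurve A := ⟨⟨_, h₁⟩, ⟨_, h₂⟩, ⟨_, h₃⟩, ⟨_, h₄⟩, ⟨_, h₆⟩⟩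
  have hW : W₀.map A.subtype = W := rfl
  have hΔ₀ : A.subtype W₀.Δ = W.Δ := by rw [← map_Δ, hW]
  let r := IsLocalRing.residue A
  have hE : (W₀.map r).IsElliptic := by
    rw [isElliptic_iff, map_Δ]
    exact (Valuation.isUnit_valuationSubring_iff.mpr (by rwa [← hΔ₀] at hΔ)).map r
  let x₀ : A := ⟨x, hx⟩
  let y₀ : A := ⟨y, hy⟩
  have heq : W₀.toAffine.Equation x₀ y₀ :=
    (W₀.toAffine.map_equation (f := A.subtype) A.subtype_injective x₀ y₀).mp hxy
  have hns := (Affine.equation_iff_nonsingular.mp (heq.map r))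
  have hle : v (3 * x ^ 2 + 2 * W.a₂ * x + W.a₄ - W.a₁ * y) ≤ 1 :=
    (3 * x₀ ^ 2 + 2 * W₀.a₂ * x₀ + W₀.a₄ - W₀.a₁ * y₀).2
  refine hle.antisymm (not_lt.mp fun hlt ↦ ?_)
  have hX : r (3 * x₀ ^ 2 + 2 * W₀.a₂ * x₀ + W₀.a₄ - W₀.a₁ * y₀) = 0 :=
    Valuation.residue_eq_zero_iff.mpr hlt
  have hY' : r (2 * y₀ + W₀.a₁ * x₀ + W₀.a₃) = 0 := Valuation.residue_eq_zero_iff.mpr hY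
  rw [Affine.nonsingular_iff] at hns
  simp only [map_add, map_sub, map_mul, map_pow, map_ofNat] at hX hY'
  rcases hns.2 with h' | h'
  · refine h' ?_
    simp only [map_a₁, map_a₂, map_a₄]
    linear_combination -hX
  · refine h' ?_
    simp only [map_a₁, map_a₃]
    linear_combination hY'

namespace Affine.Point

lemma one_lt_valuation_addX {x₁ x₂ l : F} (hx₁ : v x₁ ≤ 1) (hx₂ : v x₂ ≤ 1) (hl : 1 < v l) :
    1 < v (W.toAffine.addX x₁ x₂ l) := by
  have e : W.toAffine.addX x₁ x₂ l = l ^ 2 + (W.a₁ * l + (-W.a₂ - x₁ - x₂)) := by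
    rw [addX]; ring
  have h1 : v (W.a₁ * l + (-W.a₂ - x₁ - x₂)) ≤ v l := by
    refine v.map_add_le ?_ (le_trans ?_ hl.le)
    · rw [map_mul]
      exact mul_le_of_le_one_left' h.1
    · refine v.map_sub_le (v.map_sub_le ?_ hx₁) hx₂
      rw [Valuation.map_neg]
      exact h.2.1
  have h2 : v l < v l ^ 2 := lt_self_pow₀ hl one_lt_two
  rw [e, Valuation.map_add_eq_of_lt_left, map_pow]
  · exact hl.trans h2
  · rw [map_pow]
    exact h1.trans_lt h2

lemma valuation_yCoord_le_one {P : W.toAffine.Point} (hP : P ≠ 0) (hx : v P.xCoord ≤ 1) :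
    v P.yCoord ≤ 1 := by
  by_contra hy
  have hy := not_le.mp hy
  have eP := equation_of_ne_zero hP
  obtain ⟨h₁, h₂, h₃, h₄, h₆⟩ := h
  have e : P.yCoord * (P.yCoord + (W.a₁ * P.xCoord + W.a₃)) =
      P.xCoord ^ 3 + W.a₂ * P.xCoord ^ 2 + W.a₄ * P.xCoord + W.a₆ := by
    linear_combination eP
  let X : v.valuationSubring := ⟨_, hx⟩
  let A₁ : v.valuationSubring := ⟨_, h₁⟩
  let A₂ : v.valuationSubring := ⟨_, h₂⟩
  let A₃ : v.valuationSubring := ⟨_, h₃⟩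
  let A₄ : v.valuationSubring := ⟨_, h₄⟩
  let A₆ : v.valuationSubring := ⟨_, h₆⟩
  have hl : v (W.a₁ * P.xCoord + W.a₃) ≤ 1 :=
    (A₁ * X + A₃).2
  have hr : v (P.xCoord ^ 3 + W.a₂ * P.xCoord ^ 2 + W.a₄ * P.xCoord + W.a₆) ≤ 1 :=
    by
      have := (X ^ 3 + A₂ * X ^ 2 + A₄ * X + A₆).2
      exact this
  rw [← e, map_mul, Valuation.map_add_eq_of_lt_left _ (hl.trans_lt hy)] at hr
  exact hr.not_gt (one_lt_mul'' hy hy)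

variable [DecidableEq F]

/-- Distinct integral points of good reduction with the same reduction differ by a point reducing
to the identity. -/
lemma one_lt_valuation_xCoord_sub (hΔ : v W.Δ = 1) {P Q : W.toAffine.Point} (hP : P ≠ 0)
    (hQ : Q ≠ 0) (hPQ : P ≠ Q) (hxP : v P.xCoord ≤ 1) (hyP : v P.yCoord ≤ 1)
    (hxQ : v Q.xCoord ≤ 1) (hyQ : v Q.yCoord ≤ 1) (hx : v (P.xCoord - Q.xCoord) < 1)
    (hy : v (P.yCoord - Q.yCoord) < 1) : 1 < v (P - Q).xCoord := by
  have eP := equation_of_ne_zero hP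
  have eQ := equation_of_ne_zero hQ
  have hQ' := (nonsingular_of_ne_zero hQ).1
  have hP' := (nonsingular_of_ne_zero hP).1
  by_cases hne : P.xCoord = Q.xCoord
  · have hPQ' : P = -Q := ((xCoord_eq_iff hP hQ).mp hne).resolve_left hPQ
    have hη : P.yCoord - Q.yCoord = P.eta := by
      have : Q = -P := by rw [hPQ', neg_neg]
      rw [this]
      rcases P with _ | ⟨x, y, hxy⟩
      · exact absurd rfl hP
      rw [neg_some, yCoord_some, yCoord_some, eta_some, negY]
      ring
    have hη0 : P.eta ≠ 0 := by
      rw [← hη, sub_ne_zero]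
      intro hy
      apply hPQ
      rw [eq_some_of_ne_zero hP, eq_some_of_ne_zero hQ]
      congr
    have h2 : P - Q = 2 • P := by
      rw [two_nsmul, hPQ', sub_eq_add_neg]
    have hη1 : v P.eta < 1 := hη ▸ hy
    have hX := valuation_partialDeriv_eq_one h hΔ hxP hyP hP' hη1
    have hm := xCoord_two_smul_mul hP hη0
    -- The numerator of the duplication formula is the square of the `X`-derivative modulo `eta`,
    -- hence a unit, while the denominator `eta²` is not.
    have he : P.xCoord ^ 4 - W.b₄ * P.xCoord ^ 2 - 2 * W.b₆ * P.xCoord - W.b₈ =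
        (3 * P.xCoord ^ 2 + 2 * W.a₂ * P.xCoord + W.a₄ - W.a₁ * P.yCoord) ^ 2 + P.eta *
          (W.a₁ * (3 * P.xCoord ^ 2 + 2 * W.a₂ * P.xCoord + W.a₄ - W.a₁ * P.yCoord) -
            (W.a₂ + 2 * P.xCoord) * P.eta) := by
      rw [b₄, b₆, b₈, eta]
      linear_combination (W.a₁ ^ 2 + 4 * W.a₂ + 8 * P.xCoord) * eP
    have hle : v (W.a₁ * (3 * P.xCoord ^ 2 + 2 * W.a₂ * P.xCoord + W.a₄ - W.a₁ * P.yCoord) -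
        (W.a₂ + 2 * P.xCoord) * P.eta) ≤ 1 := by
      obtain ⟨h₁, h₂, h₃, h₄, h₆⟩ := h
      refine v.map_sub_le ?_ ?_
      · rw [map_mul, hX, mul_one]
        exact h₁
      · rw [map_mul]
        refine mul_le_one' ?_ hη1.le
        exact ((⟨_, h₂⟩ : v.valuationSubring) + 2 * ⟨_, hxP⟩).2
    have hlt : v (P.eta * (W.a₁ * (3 * P.xCoord ^ 2 + 2 * W.a₂ * P.xCoord + W.a₄ -
        W.a₁ * P.yCoord) - (W.a₂ + 2 * P.xCoord) * P.eta)) < 1 := by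
      rw [map_mul]
      exact (mul_le_of_le_one_right' hle).trans_lt hη1
    have hm' := congrArg v hm
    rw [he, Valuation.map_add_eq_of_lt_left _ (by rwa [map_pow, hX, one_pow]), map_mul, map_pow,
      map_pow, hX, one_pow] at hm'
    rw [h2]
    by_contra hcon
    have h3 := mul_le_of_le_one_left' (a := v P.eta ^ 2) (not_lt.mp hcon)
    rw [hm'] at h3
    exact h3.not_gt (pow_lt_one' hη1 two_ne_zero)
  · have hne' := sub_ne_zero.mpr hne
    rw [sub_some_of_xCoord_ne hP hQ hne]
    refine one_lt_valuation_addX h hxP hxQ ?_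
    set x := P.xCoord
    set y := P.yCoord
    set u := Q.xCoord
    set w := Q.yCoord
    have hvx : v (x - u) ≠ 0 := v.ne_zero_iff.mpr hne'
    have hvx0 := zero_lt_iff.mpr hvx
    -- The slope for `P - Q` thus has two expressions, with denominators `x - u` and `y - w` of
    -- valuation less than one. Their numerators reduce to the `Y`- and `X`-derivatives up to sign,
    -- and one of these is a unit.
    have hmul : (y - W.toAffine.negY u w) * (y - w) =
        (x - u) * (x ^ 2 + x * u + u ^ 2 + W.a₂ * (x + u) + W.a₄ - W.a₁ * y) := by
      rw [negY]
      linear_combination eP - eQ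
    have hn₁ : y - W.toAffine.negY u w = (2 * w + W.a₁ * u + W.a₃) + (y - w) := by
      rw [negY]; ring
    have hle : v (2 * w + W.a₁ * u + W.a₃) ≤ 1 := by
      exact (2 * (⟨_, hyQ⟩ : v.valuationSubring) + ⟨_, h.1⟩ * ⟨_, hxQ⟩ + ⟨_, h.2.2.1⟩).2
    rcases hle.lt_or_eq with hlt | heq
    · have hX := valuation_partialDeriv_eq_one h hΔ hxQ hyQ hQ' hlt
      have hn₂ : v (x ^ 2 + x * u + u ^ 2 + W.a₂ * (x + u) + W.a₄ - W.a₁ * y) = 1 := by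
        have e : x ^ 2 + x * u + u ^ 2 + W.a₂ * (x + u) + W.a₄ - W.a₁ * y =
            (3 * u ^ 2 + 2 * W.a₂ * u + W.a₄ - W.a₁ * w) +
              ((x + 2 * u + W.a₂) * (x - u) - W.a₁ * (y - w)) := by ring
        have h1 : v (x + 2 * u + W.a₂) ≤ 1 :=
          by
          have := ((⟨x, hxP⟩ : v.valuationSubring) + 2 * (⟨u, hxQ⟩ : v.valuationSubring) +
            (⟨W.a₂, h.2.1⟩ : v.valuationSubring)).2
          exact this
        rw [e, Valuation.map_add_eq_of_lt_left, hX]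
        rw [hX]
        refine v.map_sub_lt ?_ ?_ <;> rw [map_mul]
        · exact (mul_le_of_le_one_left' h1).trans_lt hx
        · exact (mul_le_of_le_one_left' h.1).trans_lt hy
      have hm := congrArg v hmul
      rw [map_mul, map_mul, hn₂, mul_one] at hm
      rw [map_div₀, one_lt_div₀ hvx0, ← hm]
      have h0 : v (y - W.toAffine.negY u w) ≠ 0 := left_ne_zero_of_mul (hm ▸ hvx)
      exact mul_lt_of_lt_one_right (zero_lt_iff.mpr h0) hy
    · have : v (y - W.toAffine.negY u w) = 1 := by
        rw [hn₁, Valuation.map_add_eq_of_lt_left _ (heq ▸ hy), heq]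
      rw [map_div₀, this, one_lt_div₀ hvx0]
      exact hx

end Affine.Point

end Reduction

namespace Affine.Point

variable {p : ℕ} [Fact p.Prime] {F Γ : Type*} [Field F] [Algebra ℚ F] [DecidableEq F]
  [LinearOrderedCommGroupWithZero Γ] {v : Valuation F Γ} {E : WeierstrassCurve ℚ}
  (hE : E.IsSupersingularModelAt p) (hp : v p < 1) {m : ℕ} (hm : m.Coprime p)
include hE hp hm

/-- The leading coefficient `m²` of `ΨSq m` is a unit at a place above `p`, so its roots are
integral there. -/
lemma valuation_xCoord_le_one {P : (E⁄F).toAffine.Point} (hP : P ≠ 0) (hmP : m • P = 0) :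
    v P.xCoord ≤ 1 := by
  by_contra hx
  have hx := not_le.mp hx
  have h := Valuation.eval_eq_pow (natDegree_ΨSq_le (E⁄F) m) (hE.valuation_coeff_ΨSq_le_one hp m)
    (by
      rw [coeff_ΨSq, map_pow, Valuation.map_intCast_eq_one hp, one_pow]
      exact Nat.isCoprime_iff_coprime.mpr hm) hx
  rw [(eval_ΨSq_eq_zero_iff hP m).mpr hmP, _root_.map_zero] at h
  exact pow_ne_zero _ (zero_lt_one.trans hx).ne' h.symm

/-- An automorphism acting trivially on the residue field at a place above `p` fixes the torsion
points of order prime to `p`. -/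
lemma map_eq_self_of_coprime (σ : F →ₐ[ℚ] F) (hσ : ∀ x, v x ≤ 1 → v (σ x - x) < 1)
    (P : (E⁄F).toAffine.Point) (hmP : m • P = 0) : map σ P = P := by
  by_contra hne
  have hP : P ≠ 0 := by
    rintro rfl
    exact hne (_root_.map_zero _)
  have hσP : map σ P ≠ 0 := by
    rwa [Ne, map_eq_zero_iff _ (map_injective σ)]
  have hmσ : m • map σ P = 0 := by rw [← map_nsmul, hmP, _root_.map_zero]
  have ha := hE.valuation_a_le_one hp
  have hx := valuation_xCoord_le_one hE hp hm hP hmP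
  have hy := valuation_yCoord_le_one ha hP hx
  have hσx := valuation_xCoord_le_one hE hp hm hσP hmσ
  have hσy := valuation_yCoord_le_one ha hσP hσx
  have ex : (map σ P).xCoord = σ P.xCoord := by
    rcases P with _ | ⟨x, y, hxy⟩
    · exact absurd rfl hP
    · rfl
  have ey : (map σ P).yCoord = σ P.yCoord := by
    rcases P with _ | ⟨x, y, hxy⟩
    · exact absurd rfl hP
    · rfl
  -- The difference of `P` and its conjugate reduces to the identity, yet it is `m`-torsion and so
  -- has an integral `x`-coordinate.
  have h1 := one_lt_valuation_xCoord_sub ha (hE.valuation_Δ hp) hσP hP hne hσx hσy hx hy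
    (by rw [ex]; exact hσ _ hx) (by rw [ey]; exact hσ _ hy)
  refine h1.not_ge (valuation_xCoord_le_one hE hp hm (sub_ne_zero.mpr hne) ?_)
  rw [smul_sub, hmP, hmσ, sub_zero]

end Affine.Point

end WeierstrassCurve

/-! ### Inertia groups and ramification indices -/

section Ramification

open IsDedekindDomain

/-- If the inertia group of a prime of a Galois extension of `ℚ` fixes a subfield, then this prime
is unramified in the subfield. -/
theorem Ideal.ramificationIdx_under_eq_one_of_inertia {K F : Type*} [Field K] [NumberField K]
    [Field F] [NumberField F] [Algebra K F] [IsGalois ℚ F] (Q : Ideal (𝓞 F)) [Q.IsPrime]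
    (hQ : Q ≠ ⊥)
    (h : ∀ σ ∈ Q.inertia Gal(F/ℚ), ∀ x : K, σ (algebraMap K F x) = algebraMap K F x) :
    (Q.under (𝓞 K)).ramificationIdx ℤ = 1 := by
  have : IsGalois K F := IsGalois.tower_top_of_isGalois ℚ K F
  have hQm : Q.IsMaximal := Ideal.IsPrime.isMaximal inferInstance hQ
  have hKm : (Q.under (𝓞 K)).IsMaximal := inferInstance
  have hZm : (Q.under ℤ).IsMaximal := inferInstance
  have hZ : Nat.card (Q.inertia Gal(F/ℚ)) = Q.ramificationIdx ℤ := by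
    rw [Ideal.card_inertia_eq_ramificationIdxIn (Q.under ℤ) Q,
      Ideal.ramificationIdxIn_eq_ramificationIdx (Q.under ℤ) Q Gal(F/ℚ)]
  have hK : Nat.card (Q.inertia Gal(F/K)) = Q.ramificationIdx (𝓞 K) := by
    rw [Ideal.card_inertia_eq_ramificationIdxIn (Q.under (𝓞 K)) Q,
      Ideal.ramificationIdxIn_eq_ramificationIdx (Q.under (𝓞 K)) Q Gal(F/K)]
  -- Inertia over `ℚ` fixes `K`, hence embeds in inertia over `K`; the orders are ramification
  -- indices, and multiplicativity in towers leaves index one for `K` over `ℚ`.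
  have hle : Nat.card (Q.inertia Gal(F/ℚ)) ≤ Nat.card (Q.inertia Gal(F/K)) := by
    let f : Q.inertia Gal(F/ℚ) → Q.inertia Gal(F/K) := fun σ ↦
      ⟨AlgEquiv.ofRingEquiv (f := σ.1.toRingEquiv) (h σ.1 σ.2), fun x ↦ σ.2 x⟩
    refine Nat.card_le_card_of_injective f fun σ τ hστ ↦ ?_
    ext x
    exact DFunLike.congr_fun (congrArg Subtype.val hστ) x
  have htow := Ideal.ramificationIdx_tower (R := ℤ) (Q.under (𝓞 K)) Q
  have hpos := Q.ramificationIdx_pos (𝓞 K)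
  have hpos' := (Q.under (𝓞 K)).ramificationIdx_pos ℤ
  rw [hZ, hK, htow] at hle
  exact le_antisymm (by nlinarith) hpos'

/-- Elements of the inertia group act trivially on the residue field. -/
lemma Ideal.valuation_sub_lt_one_of_mem_inertia {F : Type*} [Field F] [NumberField F]
    (Q : HeightOneSpectrum (𝓞 F)) {σ : Gal(F/ℚ)} (hσ : σ ∈ Q.asIdeal.inertia Gal(F/ℚ)) {x : F}
    (hx : Q.valuation F x ≤ 1) : Q.valuation F (σ x - x) < 1 := by
  -- Inertia is defined on `𝓞 F`, so `x` is written as a fraction whose denominator lies outside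
  -- `Q`.
  obtain ⟨n, d, hnd⟩ := Q.exists_primeCompl_mul_eq_of_integer x hx
  have hval (a : 𝓞 F) : Q.valuation F (σ (algebraMap _ F a) - algebraMap _ F a) < 1 := by
    have h := (Q.valuation_lt_one_iff_mem (K := F) (σ • a - a)).mpr (hσ a)
    exact h
  have hd : Q.valuation F (algebraMap _ F (d : 𝓞 F)) = 1 :=
    Q.valuation_eq_one_iff_notMem.mpr d.2
  have hσd : Q.valuation F (σ (algebraMap _ F (d : 𝓞 F))) = 1 := by
    rw [← sub_add_cancel (σ (algebraMap _ F (d : 𝓞 F))) (algebraMap _ F (d : 𝓞 F)),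
      Valuation.map_add_eq_of_lt_right _ (hd.symm ▸ hval d), hd]
  have key : (σ x - x) * σ (algebraMap _ F (d : 𝓞 F)) =
      (σ (algebraMap _ F n) - algebraMap _ F n) -
        x * (σ (algebraMap _ F (d : 𝓞 F)) - algebraMap _ F (d : 𝓞 F)) := by
    rw [← hnd, map_mul]
    ring
  have h := congrArg (Q.valuation F) key
  rw [map_mul, hσd, mul_one] at h
  rw [h]
  refine Valuation.map_sub_lt _ (hval n) ?_
  rw [map_mul]
  exact (mul_le_of_le_one_left' hx).trans_lt (hval d)

/-- The valuation of `p` is an `e`-th power only if the ramification index is a multiple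
of `e`. -/
lemma Ideal.dvd_ramificationIdx_of_valuation_eq_pow {F : Type*} [Field F] [NumberField F]
    (Q : HeightOneSpectrum (𝓞 F)) {p : ℕ} (hp : p.Prime) [Q.asIdeal.LiesOver (Ideal.span {(p : ℤ)})]
    {z : F} {e : ℕ} (h : Q.valuation F p = Q.valuation F z ^ e) :
    e ∣ Q.asIdeal.ramificationIdx ℤ := by
  have hp0 : (p : 𝓞 F) ≠ 0 := by exact_mod_cast hp.ne_zero
  have hmap : (Ideal.span {(p : ℤ)}).map (algebraMap ℤ (𝓞 F)) = Ideal.span {(p : 𝓞 F)} := by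
    rw [Ideal.map_span, Set.image_singleton, map_natCast]
  have hr : Q.asIdeal.ramificationIdx ℤ = multiplicity Q.asIdeal (Ideal.span {(p : 𝓞 F)}) := by
    rw [Ideal.IsDedekindDomain.ramificationIdx_eq_multiplicity (Ideal.span {(p : ℤ)}), hmap]
    rw [hmap]
    simpa using hp.ne_zero
  have hv : Q.valuation F p = WithZero.exp (-(Q.asIdeal.ramificationIdx ℤ : ℤ)) := by
    rw [hr, ← Q.intValuation_eq_exp_neg_multiplicity hp0, ← Q.valuation_of_algebraMap (K := F)]
    simp
  rw [hv] at h
  have hz : Q.valuation F z ≠ 0 ∨ e = 0 := by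
    by_contra! hcon
    rw [hcon.1, zero_pow hcon.2] at h
    exact WithZero.exp_ne_zero h
  rcases hz with hz | rfl
  · rw [← WithZero.exp_log hz, ← WithZero.exp_nsmul, WithZero.exp_inj] at h
    rw [← Int.natCast_dvd_natCast, ← dvd_neg, h, nsmul_eq_mul]
    exact dvd_mul_right _ _
  · rw [pow_zero, ← WithZero.exp_zero, WithZero.exp_inj] at h
    rw [zero_dvd_iff]
    exact_mod_cast neg_eq_zero.mp h

end Ramification

/-! ### Fields of prime-to-`p` torsion points are unramified at `p` -/

namespace WeierstrassCurve

open IsDedekindDomain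

namespace Affine.Point

section Map

variable {E : WeierstrassCurve ℚ} {K F : Type*} [Field K] [Algebra ℚ K] [Field F] [Algebra ℚ F]
  [DecidableEq K] [DecidableEq F]

lemma xCoord_map (f : K →ₐ[ℚ] F) (P : (E⁄K).toAffine.Point) :
    (map f P).xCoord = f P.xCoord := by
  rcases P with _ | ⟨x, y, h⟩
  · exact (_root_.map_zero f).symm
  · rfl

lemma yCoord_map (f : K →ₐ[ℚ] F) (P : (E⁄K).toAffine.Point) :
    (map f P).yCoord = f P.yCoord := by
  rcases P with _ | ⟨x, y, h⟩
  · exact (_root_.map_zero f).symm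
  · rfl

lemma algHom_ext {P : (E⁄K).toAffine.Point}
    (hP : IntermediateField.adjoin ℚ {P.xCoord, P.yCoord} = ⊤) {f g : K →ₐ[ℚ] F}
    (h : map f P = map g P) : f = g := by
  refine AlgHom.ext fun z ↦ ?_
  have hz : z ∈ IntermediateField.adjoin ℚ {P.xCoord, P.yCoord} := hP ▸ IntermediateField.mem_top
  induction hz using IntermediateField.adjoin_induction with
  | mem x hx =>
    rcases hx with rfl | rfl
    · rw [← xCoord_map, h, xCoord_map]
    · rw [← yCoord_map, h, yCoord_map]
  | algebraMap q => rw [f.commutes, g.commutes]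
  | add x y _ _ hx hy => rw [map_add, map_add, hx, hy]
  | inv x _ hx => rw [map_inv₀, map_inv₀, hx]
  | mul x y _ _ hx hy => rw [map_mul, map_mul, hx, hy]

end Map

lemma valuation_natCast_lt_one {F : Type*} [Field F] [NumberField F] (Q : HeightOneSpectrum (𝓞 F))
    (p : ℕ) [hQ : Q.asIdeal.LiesOver (Ideal.span {(p : ℤ)})] : Q.valuation F p < 1 := by
  have h : algebraMap ℤ (𝓞 F) p ∈ Q.asIdeal := by
    have h1 : (p : ℤ) ∈ Q.asIdeal.under ℤ := by
      rw [← hQ.over]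
      exact Ideal.mem_span_singleton_self _
    exact h1
  have := (Q.valuation_lt_one_iff_mem (K := F) _).mpr h
  simpa using this

/-- Inertia at a prime of `F` above `𝔭` fixes the image of `P`, hence the field `K` that its
coordinates generate. -/
lemma ramificationIdx_eq_one_of_coprime_of_isGalois {p : ℕ} [Fact p.Prime] {E : WeierstrassCurve ℚ}
    (hE : E.IsSupersingularModelAt p) {m : ℕ} (hm : m.Coprime p) {K : Type*} [Field K]
    [NumberField K] [DecidableEq K] {P : (E⁄K).toAffine.Point} (hmP : m • P = 0)
    (hgen : IntermediateField.adjoin ℚ {P.xCoord, P.yCoord} = ⊤) (𝔭 : Ideal (𝓞 K)) [𝔭.IsPrime]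
    [𝔭.LiesOver (Ideal.span {(p : ℤ)})] (F : Type*) [Field F] [NumberField F] [Algebra K F]
    [IsGalois ℚ F] : 𝔭.ramificationIdx ℤ = 1 := by
  classical
  obtain ⟨Q, hQ, hQ𝔭⟩ := (inferInstance : Nonempty (𝔭.primesOver (𝓞 F)))
  have hQp : Q.LiesOver (Ideal.span {(p : ℤ)}) := Ideal.LiesOver.trans Q 𝔭 _
  have hQ0 : Q ≠ ⊥ :=
    Ideal.ne_bot_of_liesOver_of_ne_bot (p := Ideal.span {(p : ℤ)})
      (by simpa using (Fact.out : p.Prime).ne_zero) Q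
  let v : HeightOneSpectrum (𝓞 F) := ⟨Q, hQ, hQ0⟩
  have : v.asIdeal.LiesOver (Ideal.span {(p : ℤ)}) := hQp
  rw [hQ𝔭.over]
  refine Ideal.ramificationIdx_under_eq_one_of_inertia Q hQ0 fun σ hσ x ↦ ?_
  have h := map_eq_self_of_coprime hE (v := v.valuation F) (valuation_natCast_lt_one v p) hm
    σ.toAlgHom (fun y hy ↦ Ideal.valuation_sub_lt_one_of_mem_inertia v hσ hy)
    (map (IsScalarTower.toAlgHom ℚ K F) P) (by rw [← map_nsmul, hmP, _root_.map_zero])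
  rw [map_map] at h
  exact DFunLike.congr_fun (algHom_ext hgen h) x

/-- The field generated by a torsion point of order prime to `p` is unramified at `p`. -/
theorem ramificationIdx_eq_one_of_coprime {p : ℕ} [Fact p.Prime] {E : WeierstrassCurve ℚ}
    (hE : E.IsSupersingularModelAt p) {m : ℕ} (hm : m.Coprime p) {K : Type*} [Field K]
    [NumberField K] [DecidableEq K] {P : (E⁄K).toAffine.Point} (hmP : m • P = 0)
    (hgen : IntermediateField.adjoin ℚ {P.xCoord, P.yCoord} = ⊤) (𝔭 : Ideal (𝓞 K)) [𝔭.IsPrime]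
    [𝔭.LiesOver (Ideal.span {(p : ℤ)})] : 𝔭.ramificationIdx ℤ = 1 := by
  have : IsAlgClosure ℚ (AlgebraicClosure K) :=
    ⟨inferInstance, Algebra.IsAlgebraic.trans ℚ K (AlgebraicClosure K)⟩
  have : Normal ℚ (AlgebraicClosure K) := IsAlgClosure.normal ℚ _
  let F := IntermediateField.normalClosure ℚ K (AlgebraicClosure K)
  have : NumberField F := { to_charZero := inferInstance, to_finiteDimensional := inferInstance }
  have : Normal ℚ F := normalClosure.normal ℚ K (AlgebraicClosure K)
  have : IsGalois ℚ F := { }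
  exact ramificationIdx_eq_one_of_coprime_of_isGalois hE hm hmP hgen 𝔭 F

end Affine.Point

end WeierstrassCurve

/-! ### Counting points of prime power order -/

namespace WeierstrassCurve.Affine.Point

section Count

open Polynomial

variable {F : Type*} [Field F] [DecidableEq F] [CharZero F] {W : Affine F} {p : ℕ} (hp : p.Prime)
include hp

/-- For odd `p` the `x`-coordinates are roots of `preΨ p`, of degree at most `(p ^ 2 - 1) / 2`, and
each carries at most two points. For `p = 2` points equal their negatives, so `x` is injective on
them, and `Ψ₂Sq` is a cubic. -/
lemma card_le_of_addOrderOf_eq_prime (s : Finset W.Point) (hs : ∀ P ∈ s, addOrderOf P = p) :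
    s.card ≤ p ^ 2 - 1 := by
  have hs0 : ∀ P ∈ s, P ≠ 0 := by
    rintro P hP rfl
    have := hs _ hP
    rw [addOrderOf_zero] at this
    exact hp.one_lt.ne this
  have hsp : ∀ P ∈ s, p • P = 0 := fun P hP ↦ hs P hP ▸ addOrderOf_nsmul_eq_zero P
  have key {f : F[X]} (hf : f ≠ 0) (hroot : ∀ P ∈ s, f.eval P.xCoord = 0) :
      (s.image xCoord).card ≤ f.natDegree := by
    refine le_trans (Finset.card_le_card (t := f.roots.toFinset) fun x hx ↦ ?_)
      ((Multiset.toFinset_card_le _).trans f.card_roots')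
    obtain ⟨P, hP, rfl⟩ := Finset.mem_image.mp hx
    simpa [hf] using hroot P hP
  rcases hp.eq_two_or_odd' with rfl | hodd
  · have hinj : Set.InjOn (xCoord (W := W)) s := by
      intro P hP Q hQ h
      rcases (xCoord_eq_iff (hs0 P hP) (hs0 Q hQ)).mp h with h | h
      · exact h
      · rw [h, neg_eq_iff_add_eq_zero, ← two_nsmul]
        exact hsp Q hQ
    rw [← Finset.card_image_of_injOn hinj]
    have h0 : W.Ψ₂Sq ≠ 0 := by
      intro h
      have := W.coeff_Ψ₂Sq
      rw [h, coeff_zero] at this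
      norm_num at this
    refine (key h0 fun P hP ↦ ?_).trans (natDegree_Ψ₂Sq_le _)
    rw [← ΨSq_two]
    exact (eval_ΨSq_eq_zero_iff (hs0 P hP) 2).mpr (hsp P hP)
  · have hodd' : ¬ Even (p : ℤ) := by simpa using hodd
    have hN : ((p : ℤ).natAbs ^ 2 - if Even (p : ℤ) then 4 else 1) / 2 = (p ^ 2 - 1) / 2 := by
      simp [hodd']
    have hdeg := hN ▸ W.natDegree_preΨ_le p
    have h0 : W.preΨ p ≠ 0 := by
      intro h
      have := W.coeff_preΨ p
      rw [h, coeff_zero, if_neg hodd', eq_comm] at this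
      exact hp.ne_zero (by exact_mod_cast this)
    have h2 := Finset.card_le_mul_card_image (f := xCoord) s 2 fun x hx ↦ by
      obtain ⟨P, hP, rfl⟩ := Finset.mem_image.mp hx
      refine (Finset.card_le_card (t := {P, -P}) fun Q hQ ↦ ?_).trans Finset.card_le_two
      rw [Finset.mem_filter] at hQ
      simpa using (xCoord_eq_iff (hs0 Q hQ.1) (hs0 P hP)).mp hQ.2
    have h3 := (key h0 fun P hP ↦ by
      rw [← psi_of_odd (hs0 P hP) hodd', psi_eq_zero_iff (hs0 P hP)]
      exact hsp P hP).trans hdeg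
    omega

/-- The number of points of order `p ^ (n + 1)` over a field of characteristic zero is at most
`p ^ (2n + 2) - p ^ (2n)`. -/
theorem card_le_of_addOrderOf_eq_prime_pow (n : ℕ) (s : Finset W.Point)
    (hs : ∀ P ∈ s, addOrderOf P = p ^ (n + 1)) :
    s.card ≤ p ^ (2 * (n + 1)) - p ^ (2 * (n + 1) - 2) := by
  have he (n : ℕ) : p ^ (2 * (n + 1)) - p ^ (2 * (n + 1) - 2) = (p ^ 2 - 1) * p ^ (2 * n) := by
    rw [Nat.sub_mul, one_mul, ← pow_add]
    congr 2
    ring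
  rw [he]
  induction n generalizing s with
  | zero => simpa using card_le_of_addOrderOf_eq_prime hp s (by simpa using hs)
  | succ n ih =>
    -- Translating a fibre of multiplication by `p` to contain zero turns its other members into
    -- points of order `p`, so it has at most `(p ^ 2 - 1) + 1` elements.
    have h := Finset.card_le_mul_card_image (f := (p • ·)) s (p ^ 2) fun x hx ↦ by
      obtain ⟨P, hP, rfl⟩ := Finset.mem_image.mp hx
      have := Fact.mk hp
      set t := s.filter fun Q ↦ p • Q = p • P
      have ht : ((t.image (· - P)).erase 0).card ≤ p ^ 2 - 1 := by
        refine card_le_of_addOrderOf_eq_prime hp _ fun R hR ↦ ?_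
        obtain ⟨hR0, hR⟩ := Finset.mem_erase.mp hR
        obtain ⟨Q, hQ, rfl⟩ := Finset.mem_image.mp hR
        have hpR : p • (Q - P) = 0 := by
          rw [smul_sub, (Finset.mem_filter.mp hQ).2, sub_self]
        exact addOrderOf_eq_prime_iff.mpr ⟨hpR, hR0⟩
      rw [← Finset.card_image_of_injective t (sub_left_injective (b := P))]
      have := Finset.pred_card_le_card_erase (s := t.image (· - P)) (a := 0)
      have := hp.pos
      have : 0 < p ^ 2 := by positivity
      omega
    have h' := ih (s.image (p • ·)) fun x hx ↦ by
      obtain ⟨P, hP, rfl⟩ := Finset.mem_image.mp hx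
      rw [addOrderOf_nsmul' P hp.ne_zero, hs P hP, Nat.gcd_eq_right (dvd_pow_self _ (by omega)),
        pow_succ, Nat.mul_div_cancel _ hp.pos]
    calc s.card ≤ p ^ 2 * (s.image (p • ·)).card := h
      _ ≤ p ^ 2 * ((p ^ 2 - 1) * p ^ (2 * n)) := by gcongr
      _ = (p ^ 2 - 1) * p ^ (2 * (n + 1)) := by ring

end Count

end WeierstrassCurve.Affine.Point

/-! ### Ramification and degree of the field of a torsion point -/

lemma NumberField.ramificationIdx_le_finrank {K L : Type*} [Field K] [NumberField K] [Field L]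
    [NumberField L] [Algebra K L] (P : Ideal (𝓞 L)) [P.IsPrime] :
    P.ramificationIdx (𝓞 K) ≤ Module.finrank K L := by
  classical
  let p := P.under (𝓞 K)
  have : Fintype (p.primesOver (𝓞 L)) := (Algebra.QuasiFinite.finite_primesOver p).fintype
  have h := Ideal.sum_ramification_inertia_eq_finrank p (𝓞 L)
  rw [IsFractionRing.finrank_eq (𝓞 K) K (𝓞 L) L, ← h]
  refine le_trans ?_ (Finset.single_le_sum (fun _ _ ↦ Nat.zero_le _)
    (Finset.mem_univ (Ideal.primesOver.mk p P)))
  exact Nat.le_mul_of_pos_right _ (P.inertiaDeg_pos (𝓞 K))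

namespace WeierstrassCurve

namespace Affine.Point

universe u

open scoped Classical in
/-- A point is defined over the field generated by its coordinates. -/
lemma exists_map_eq_of_fieldRange_eq {E : WeierstrassCurve ℚ} {K L : Type*} [Field K] [Field L]
    [Algebra ℚ K] [Algebra ℚ L] (f : K →ₐ[ℚ] L) (P : (E⁄L).toAffine.Point)
    (hf : f.fieldRange = IntermediateField.adjoin ℚ {P.xCoord, P.yCoord}) :
    ∃ P' : (E⁄K).toAffine.Point, map f P' = P ∧
      IntermediateField.adjoin ℚ {P'.xCoord, P'.yCoord} = ⊤ := by
  have key (P' : (E⁄K).toAffine.Point) (h : map f P' = P) :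
      IntermediateField.adjoin ℚ {P'.xCoord, P'.yCoord} = ⊤ := by
    apply IntermediateField.map_injective f
    rw [IntermediateField.adjoin_map, Set.image_pair, ← xCoord_map, ← yCoord_map, h, ← hf,
      ← AlgHom.fieldRange_eq_map]
  suffices ∃ P', map f P' = P from this.imp fun P' h ↦ ⟨h, key P' h⟩
  have hx : P.xCoord ∈ f.fieldRange := hf ▸ IntermediateField.subset_adjoin _ _ (by simp)
  have hy : P.yCoord ∈ f.fieldRange := hf ▸ IntermediateField.subset_adjoin _ _ (by simp)
  clear key hf
  rcases P with _ | ⟨x, y, h⟩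
  · exact ⟨0, _root_.map_zero _⟩
  · obtain ⟨x', rfl⟩ := hx
    obtain ⟨y', rfl⟩ := hy
    exact ⟨.some x' y' ((E.toAffine.baseChange_nonsingular (f := f) f.injective _ _).mp h), rfl⟩

open scoped Classical in
-- The field of definition stays in the universe of `L`, as is needed to compare it with a minimal
-- torsion point field.
lemma exists_numberField_map_eq {E : WeierstrassCurve ℚ} {L : Type u} [Field L] [NumberField L]
    (P : (E⁄L).toAffine.Point) :
    ∃ (K : Type u) (_ : Field K) (_ : NumberField K) (_ : Algebra K L) (P' : (E⁄K).toAffine.Point),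
      map (IsScalarTower.toAlgHom ℚ K L) P' = P ∧
        IntermediateField.adjoin ℚ {P'.xCoord, P'.yCoord} = ⊤ := by
  let K := IntermediateField.adjoin ℚ {P.xCoord, P.yCoord}
  refine ⟨K, inferInstance, inferInstance, inferInstance, exists_map_eq_of_fieldRange_eq _ P ?_⟩
  ext x
  exact ⟨fun ⟨y, hy⟩ ↦ hy ▸ y.2, fun h ↦ ⟨⟨x, h⟩, rfl⟩⟩

open scoped Classical in
/-- A change of variables over `ℚ` preserves the order of a point and the field it generates. -/
lemma exists_point_variableChange {E : WeierstrassCurve ℚ} [E.IsElliptic] (C : VariableChange ℚ)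
    {L : Type*} [Field L] [Algebra ℚ L] (P : (E⁄L).toAffine.Point) :
    ∃ Q : ((C • E)⁄L).toAffine.Point, addOrderOf Q = addOrderOf P ∧
      IntermediateField.adjoin ℚ {Q.xCoord, Q.yCoord} =
        IntermediateField.adjoin ℚ {P.xCoord, P.yCoord} := by
  have hmap : (C.map (algebraMap ℚ L)) • (E⁄L) = (C • E)⁄L := map_variableChange ..
  rw [← hmap]
  have : (E⁄L).IsElliptic := inferInstanceAs (E.map _).IsElliptic
  refine ⟨variableChangeHom (W := E⁄L) (C.map (algebraMap ℚ L)) P,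
    addOrderOf_injective _ (variableChangeHom_injective _) P, ?_⟩
  rcases P with _ | ⟨x, y, h⟩
  · rfl
  rw [variableChangeHom_some, xCoord_some, yCoord_some, xCoord_some, yCoord_some]
  have hu : (C.map (algebraMap ℚ L)).u⁻¹ = algebraMap ℚ L (↑C.u⁻¹ : ℚ) := by simp
  have hu0 : algebraMap ℚ L (↑C.u⁻¹ : ℚ) ≠ 0 := (map_ne_zero _).mpr C.u⁻¹.ne_zero
  rw [hu]
  set K₁ := IntermediateField.adjoin ℚ {algebraMap ℚ L (↑C.u⁻¹ : ℚ) ^ 2 * (x - algebraMap ℚ L C.r),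
    algebraMap ℚ L (↑C.u⁻¹ : ℚ) ^ 3 *
      (y - algebraMap ℚ L C.s * (x - algebraMap ℚ L C.r) - algebraMap ℚ L C.t)} with hK₁
  have hq (K : IntermediateField ℚ L) (q : ℚ) : algebraMap ℚ L q ∈ K := K.algebraMap_mem q
  change K₁ = _
  refine le_antisymm (IntermediateField.adjoin_le_iff.mpr ?_)
    (IntermediateField.adjoin_le_iff.mpr ?_)
  · have hx : x ∈ IntermediateField.adjoin ℚ {x, y} :=
      IntermediateField.subset_adjoin _ _ (by simp)
    have hy : y ∈ IntermediateField.adjoin ℚ {x, y} :=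
      IntermediateField.subset_adjoin _ _ (by simp)
    rintro _ (rfl | rfl)
    · exact mul_mem (pow_mem (hq _ _) _) (sub_mem hx (hq _ _))
    · exact mul_mem (pow_mem (hq _ _) _)
        (sub_mem (sub_mem hy (mul_mem (hq _ _) (sub_mem hx (hq _ _)))) (hq _ _))
  · have hcancel {a b : L} (ha : a ∈ K₁) (ha0 : a ≠ 0) (hab : a * b ∈ K₁) : b ∈ K₁ := by
      have := mul_mem (inv_mem ha) hab
      rwa [inv_mul_cancel_left₀ ha0] at this
    have hx : x - algebraMap ℚ L C.r ∈ K₁ := hcancel (pow_mem (hq _ _) _) (pow_ne_zero 2 hu0)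
      (IntermediateField.subset_adjoin _ _ (by simp))
    have hy : y - algebraMap ℚ L C.s * (x - algebraMap ℚ L C.r) - algebraMap ℚ L C.t ∈ K₁ :=
      hcancel (pow_mem (hq _ _) _) (pow_ne_zero 3 hu0)
        (IntermediateField.subset_adjoin _ _ (by simp))
    rintro _ (rfl | rfl)
    · simpa using add_mem hx (hq _ C.r)
    · simpa using add_mem (add_mem hy (hq _ C.t)) (mul_mem (hq _ C.s) hx)

variable {p : ℕ} [Fact p.Prime] {E : WeierstrassCurve ℚ} {L : Type*} [Field L] [NumberField L]

open scoped Classical in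
lemma dvd_ramificationIdx_of_addOrderOf [E.IsElliptic] {C : VariableChange ℚ}
    (hC : (C • E).IsSupersingularModelAt p) {n : ℕ} {P : (E⁄L).toAffine.Point}
    (hP : addOrderOf P = p ^ (n + 1)) (𝔓 : Ideal (𝓞 L)) [𝔓.IsPrime]
    [𝔓.LiesOver (Ideal.span {(p : ℤ)})] :
    p ^ (2 * (n + 1)) - p ^ (2 * (n + 1) - 2) ∣ 𝔓.ramificationIdx ℤ := by
  have hp : p.Prime := Fact.out
  have h0 : 𝔓 ≠ ⊥ := Ideal.ne_bot_of_liesOver_of_ne_bot (p := Ideal.span {(p : ℤ)})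
      (by simpa using hp.ne_zero) 𝔓
  let v : IsDedekindDomain.HeightOneSpectrum (𝓞 L) := ⟨𝔓, ‹_›, h0⟩
  have : v.asIdeal.LiesOver (Ideal.span {(p : ℤ)}) := ‹𝔓.LiesOver _›
  obtain ⟨Q, hQ, -⟩ := exists_point_variableChange C P
  obtain ⟨z, hz⟩ := hC.exists_valuation_pow (v := v.valuation L) (valuation_natCast_lt_one v p) n
    (hQ.trans hP)
  exact Ideal.dvd_ramificationIdx_of_valuation_eq_pow v hp hz

variable {K : Type*} [Field K] [NumberField K] [Algebra K L] {n M : ℕ} (hM : M.Coprime p)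

open scoped Classical in
include hM in
-- All `K`-embeddings of `L` agree on `p ^ (n + 1) • P`, which is defined over `K`. By coprimality
-- one that is known on `M • P` is known on `P`, hence on `L`; so embeddings inject into the points
-- of order `p ^ (n + 1)`.
lemma finrank_le_of_addOrderOf {P : (E⁄L).toAffine.Point} (hP : addOrderOf P = p ^ (n + 1) * M)
    (hM0 : M ≠ 0) (hgen : IntermediateField.adjoin ℚ {P.xCoord, P.yCoord} = ⊤)
    {P' : (E⁄K).toAffine.Point} (hP' : map (IsScalarTower.toAlgHom ℚ K L) P' = p ^ (n + 1) • P) :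
    Module.finrank K L ≤ p ^ (2 * (n + 1)) - p ^ (2 * (n + 1) - 2) := by
  have hp : p.Prime := Fact.out
  let Ω := AlgebraicClosure L
  have hord : addOrderOf (M • P) = p ^ (n + 1) := by
    rw [addOrderOf_nsmul' P hM0, hP, Nat.gcd_mul_left_left, Nat.mul_div_cancel _ (by omega)]
  let f : (L →ₐ[K] Ω) → (E⁄Ω).toAffine.Point := fun τ ↦ map (τ.restrictScalars ℚ) (M • P)
  have hf : Function.Injective f := by
    intro τ τ' h
    have h1 : map (τ.restrictScalars ℚ) (p ^ (n + 1) • P) =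
        map (τ'.restrictScalars ℚ) (p ^ (n + 1) • P) := by
      rw [← hP', map_map, map_map]
      congr 2
      ext x
      exact (τ.commutes x).trans (τ'.commutes x).symm
    have h2 : map (τ.restrictScalars ℚ) P = map (τ'.restrictScalars ℚ) P := by
      rw [← sub_eq_zero, ← AddMonoid.addOrderOf_eq_one_iff]
      have hcop : Nat.Coprime M (p ^ (n + 1)) := hM.pow_right _
      refine Nat.eq_one_of_dvd_coprimes hcop ?_ ?_ <;>
      rw [addOrderOf_dvd_iff_nsmul_eq_zero, smul_sub, ← map_nsmul, ← map_nsmul, sub_eq_zero]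
      · exact h
      · exact h1
    have h3 := algHom_ext hgen h2
    exact AlgHom.ext fun x ↦ DFunLike.congr_fun h3 x
  rw [← AlgHom.card K L Ω, ← Finset.card_univ, ← Finset.card_image_of_injective _ hf]
  refine card_le_of_addOrderOf_eq_prime_pow hp n _ fun Q hQ ↦ ?_
  obtain ⟨τ, -, rfl⟩ := Finset.mem_image.mp hQ
  rw [← hord]
  exact addOrderOf_injective _ (map_injective (τ.restrictScalars ℚ)) _

open scoped Classical in
include hM in
/-- The ramification at `p` in the field generated by a torsion point, together with the degree of
this field over the field generated by the prime-to-`p` part of the point. -/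
theorem ramificationIdx_and_finrank [E.IsElliptic] {C : VariableChange ℚ}
    (hC : (C • E).IsSupersingularModelAt p) {P : (E⁄L).toAffine.Point}
    (hP : addOrderOf P = p ^ (n + 1) * M) (hM0 : M ≠ 0)
    (hgen : IntermediateField.adjoin ℚ {P.xCoord, P.yCoord} = ⊤)
    {P' : (E⁄K).toAffine.Point} (hP' : map (IsScalarTower.toAlgHom ℚ K L) P' = p ^ (n + 1) • P)
    (hgen' : IntermediateField.adjoin ℚ {P'.xCoord, P'.yCoord} = ⊤) :
    (∀ (𝔓 : Ideal (𝓞 L)) [𝔓.IsPrime] [𝔓.LiesOver (Ideal.span {(p : ℤ)})],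
      𝔓.ramificationIdx ℤ = p ^ (2 * (n + 1)) - p ^ (2 * (n + 1) - 2)) ∧
    Module.finrank K L = p ^ (2 * (n + 1)) - p ^ (2 * (n + 1) - 2) := by
  have hp : p.Prime := Fact.out
  have hle := finrank_le_of_addOrderOf hM hP hM0 hgen hP'
  have hord : addOrderOf (M • P) = p ^ (n + 1) := by
    rw [addOrderOf_nsmul' P hM0, hP, Nat.gcd_mul_left_left, Nat.mul_div_cancel _ (by omega)]
  have key (𝔓 : Ideal (𝓞 L)) [𝔓.IsPrime] [𝔓.LiesOver (Ideal.span {(p : ℤ)})] :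
      𝔓.ramificationIdx ℤ = p ^ (2 * (n + 1)) - p ^ (2 * (n + 1) - 2) ∧
      Module.finrank K L = p ^ (2 * (n + 1)) - p ^ (2 * (n + 1) - 2) := by
    have hdvd := dvd_ramificationIdx_of_addOrderOf hC hord 𝔓
    let 𝔭 := 𝔓.under (𝓞 K)
    have : 𝔭.LiesOver (Ideal.span {(p : ℤ)}) := Ideal.LiesOver.tower_bot 𝔓 𝔭 _
    have h𝔭 : 𝔭.ramificationIdx ℤ = 1 := by
      obtain ⟨Q, hQ, hQ'⟩ := exists_point_variableChange C P'
      rw [hgen'] at hQ'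
      refine ramificationIdx_eq_one_of_coprime hC hM ?_ hQ' 𝔭
      rw [← addOrderOf_dvd_iff_nsmul_eq_zero, hQ, addOrderOf_dvd_iff_nsmul_eq_zero]
      apply map_injective (W' := E) (IsScalarTower.toAlgHom ℚ K L)
      rw [map_nsmul, hP', smul_smul, mul_comm, ← hP, addOrderOf_nsmul_eq_zero, _root_.map_zero]
    have htow := Ideal.ramificationIdx_tower (R := ℤ) 𝔭 𝔓
    rw [h𝔭, one_mul] at htow
    have h1 := NumberField.ramificationIdx_le_finrank (K := K) 𝔓
    have h2 := Nat.le_of_dvd (𝔓.ramificationIdx_pos ℤ) hdvd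
    omega
  refine ⟨fun 𝔓 _ _ ↦ (key 𝔓).1, ?_⟩
  -- The degree is read off from `key` at any prime above `p`, so one has to be exhibited.
  have : (Ideal.span {(p : ℤ)}).IsPrime := by
    rw [Ideal.span_singleton_prime (by exact_mod_cast hp.ne_zero)]
    exact Nat.prime_iff_prime_int.mp hp
  obtain ⟨𝔓, _, _⟩ := (inferInstance : Nonempty ((Ideal.span {(p : ℤ)}).primesOver (𝓞 L)))
  exact (key 𝔓).2

end Affine.Point

end WeierstrassCurve

/-! ### Rational models with supersingular reduction -/

namespace WeierstrassCurve

variable {p : ℕ} [Fact p.Prime]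

lemma exists_residue_eq_of_norm_sub_lt_one (z : ℤ_[p]) {x : ℚ_[p]} (h : ‖x - z‖ < 1) :
    ∃ z' : ℤ_[p], (z' : ℚ_[p]) = x ∧
      IsLocalRing.residue ℤ_[p] z' = IsLocalRing.residue ℤ_[p] z := by
  let d : ℤ_[p] := ⟨x - z, h.le⟩
  have hd : (d : ℚ_[p]) = x - z := rfl
  refine ⟨d + z, by rw [PadicInt.coe_add, hd, sub_add_cancel], ?_⟩
  have h0 : IsLocalRing.residue ℤ_[p] d = 0 := by
    rw [IsLocalRing.residue_eq_zero_iff, IsLocalRing.mem_maximalIdeal, PadicInt.mem_nonunits]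
    exact h
  rw [map_add, h0, zero_add]

/-- A change of variables over `ℚ_[p]` can be approximated by one over `ℚ`. -/
lemma exists_variableChange_rat (E : WeierstrassCurve ℚ) (C : VariableChange ℚ_[p]) :
    ∃ C' : VariableChange ℚ,
      ‖((C' • E).a₁ : ℚ_[p]) - (C • (E⁄ℚ_[p])).a₁‖ < 1 ∧
      ‖((C' • E).a₂ : ℚ_[p]) - (C • (E⁄ℚ_[p])).a₂‖ < 1 ∧
      ‖((C' • E).a₃ : ℚ_[p]) - (C • (E⁄ℚ_[p])).a₃‖ < 1 ∧
      ‖((C' • E).a₄ : ℚ_[p]) - (C • (E⁄ℚ_[p])).a₄‖ < 1 ∧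
      ‖((C' • E).a₆ : ℚ_[p]) - (C • (E⁄ℚ_[p])).a₆‖ < 1 := by
  have hd : DenseRange (fun q : ℚ × ℚ × ℚ × ℚ ↦
      ((q.1, q.2.1, q.2.2.1, q.2.2.2) : ℚ_[p] × ℚ_[p] × ℚ_[p] × ℚ_[p])) :=
    (Padic.denseRange_ratCast p).prodMap ((Padic.denseRange_ratCast p).prodMap
      ((Padic.denseRange_ratCast p).prodMap (Padic.denseRange_ratCast p)))
  set c := C • (E⁄ℚ_[p])
  -- The first coordinate stands for `u⁻¹`, which makes the transformed coefficients polynomial and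
  -- the set visibly open.
  let U : Set (ℚ_[p] × ℚ_[p] × ℚ_[p] × ℚ_[p]) := {q | q.1 ≠ 0 ∧
    ‖q.1 * (E.a₁ + 2 * q.2.2.1) - c.a₁‖ < 1 ∧
    ‖q.1 ^ 2 * (E.a₂ - q.2.2.1 * E.a₁ + 3 * q.2.1 - q.2.2.1 ^ 2) - c.a₂‖ < 1 ∧
    ‖q.1 ^ 3 * (E.a₃ + q.2.1 * E.a₁ + 2 * q.2.2.2) - c.a₃‖ < 1 ∧
    ‖q.1 ^ 4 * (E.a₄ - q.2.2.1 * E.a₃ + 2 * q.2.1 * E.a₂ -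
      (q.2.2.2 + q.2.1 * q.2.2.1) * E.a₁ + 3 * q.2.1 ^ 2 - 2 * q.2.2.1 * q.2.2.2) - c.a₄‖ < 1 ∧
    ‖q.1 ^ 6 * (E.a₆ + q.2.1 * E.a₄ + q.2.1 ^ 2 * E.a₂ + q.2.1 ^ 3 - q.2.2.2 * E.a₃ -
      q.2.2.2 ^ 2 - q.2.1 * q.2.2.2 * E.a₁) - c.a₆‖ < 1}
  have hU : IsOpen U := by
    simp only [U, Set.ofPred_and]
    refine (isOpen_ne_fun ?_ ?_).inter <| (isOpen_lt ?_ ?_).inter <| (isOpen_lt ?_ ?_).inter <|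
      (isOpen_lt ?_ ?_).inter <| (isOpen_lt ?_ ?_).inter (isOpen_lt ?_ ?_) <;> fun_prop
  have hne : U.Nonempty := by
    refine ⟨(↑C.u⁻¹, C.r, C.s, C.t), C.u⁻¹.ne_zero, ?_⟩
    simp [c, variableChange_a₁, variableChange_a₂, variableChange_a₃, variableChange_a₄,
      variableChange_a₆]
  obtain ⟨⟨w, r, s, t⟩, hw, h₁, h₂, h₃, h₄, h₆⟩ := hd.exists_mem_open hU hne
  have hw0 : w ≠ 0 := by simpa using hw
  refine ⟨⟨(Units.mk0 w hw0)⁻¹, r, s, t⟩, ?_⟩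
  simp only [variableChange_a₁, variableChange_a₂, variableChange_a₃, variableChange_a₄,
    variableChange_a₆, inv_inv, Units.val_mk0]
  push_cast
  exact ⟨h₁, h₂, h₃, h₄, h₆⟩

/-- The minimal equation comes from a change of variables over `ℚ_[p]`. A rational one close to it
yields coefficients congruent modulo `p`, hence the same reduction, and leaves the fields generated
by points unchanged. -/
theorem HasSupersingularReductionAt.exists_isSupersingularModelAt {E : WeierstrassCurve ℚ}
    (h : E.HasSupersingularReductionAt p) :
    ∃ C : VariableChange ℚ, (C • E).IsSupersingularModelAt p := by
  obtain ⟨-, h⟩ := h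
  obtain ⟨C₀, hC₀⟩ : ∃ C₀ : VariableChange ℚ_[p],
      (E.baseChange ℚ_[p]).minimal ℤ_[p] = C₀ • (E⁄ℚ_[p]) := ⟨_, rfl⟩
  set W := (E.baseChange ℚ_[p]).minimal ℤ_[p]
  set V := integralModel ℤ_[p] W
  have hV : V⁄ℚ_[p] = C₀ • (E⁄ℚ_[p]) := (baseChange_integralModel_eq ℤ_[p] W).trans hC₀
  obtain ⟨C, h₁, h₂, h₃, h₄, h₆⟩ := exists_variableChange_rat E C₀
  rw [← hV] at h₁ h₂ h₃ h₄ h₆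
  obtain ⟨z₁, hz₁, hr₁⟩ := exists_residue_eq_of_norm_sub_lt_one V.a₁ h₁
  obtain ⟨z₂, hz₂, hr₂⟩ := exists_residue_eq_of_norm_sub_lt_one V.a₂ h₂
  obtain ⟨z₃, hz₃, hr₃⟩ := exists_residue_eq_of_norm_sub_lt_one V.a₃ h₃
  obtain ⟨z₄, hz₄, hr₄⟩ := exists_residue_eq_of_norm_sub_lt_one V.a₄ h₄
  obtain ⟨z₆, hz₆, hr₆⟩ := exists_residue_eq_of_norm_sub_lt_one V.a₆ h₆
  refine ⟨C, ⟨z₁, z₂, z₃, z₄, z₆⟩, ?_, ?_⟩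
  · ext
    exacts [by simpa using hz₁, by simpa using hz₂, by simpa using hz₃, by simpa using hz₄,
      by simpa using hz₆]
  · have : (⟨z₁, z₂, z₃, z₄, z₆⟩ : WeierstrassCurve ℤ_[p]).map (IsLocalRing.residue ℤ_[p]) =
        V.map (IsLocalRing.residue ℤ_[p]) := by
      ext
      exacts [hr₁, hr₂, hr₃, hr₄, hr₆]
    rw [this]
    exact h

end WeierstrassCurve

/-! ### Assembling the primes and using minimality -/

namespace WeierstrassCurve.Affine.Point

universe u

open scoped Classical in
/-- The degree of the field generated by a torsion point at whose order all primes are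
supersingular. -/
theorem finrank_eq_prod {E : WeierstrassCurve ℚ} [E.IsElliptic] {N : ℕ} (hN : N ≠ 0)
    (hE : ∀ (p : ℕ) [Fact p.Prime], p ∣ N → E.HasSupersingularReductionAt p)
    {L : Type u} [Field L] [NumberField L] {P : (E⁄L).toAffine.Point} (hP : addOrderOf P = N)
    (hgen : IntermediateField.adjoin ℚ {P.xCoord, P.yCoord} = ⊤) :
    Module.finrank ℚ L = ∏ p ∈ N.primeFactors,
      (p ^ (2 * N.factorization p) - p ^ (2 * N.factorization p - 2)) := by
  induction N using Nat.strong_induction_on generalizing L with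
  | _ N ih =>
    rcases eq_or_ne N 1 with rfl | hN1
    · rw [AddMonoid.addOrderOf_eq_one_iff] at hP
      subst hP
      -- The junk coordinates of the identity are both `0`, so they generate `ℚ`, as the empty
      -- product requires.
      have h0 : ({xCoord (0 : (E⁄L).toAffine.Point), yCoord (0 : (E⁄L).toAffine.Point)} : Set L) =
        {0} := Set.pair_eq_singleton _
      rw [h0, IntermediateField.adjoin_zero] at hgen
      rw [← IntermediateField.finrank_top', ← hgen, IntermediateField.finrank_bot]
      simp
    · obtain ⟨p, hp, hpN⟩ := Nat.exists_prime_and_dvd hN1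
      have := Fact.mk hp
      obtain ⟨k, M, hpM, hk⟩ := Nat.exists_eq_pow_mul_and_not_dvd hN p hp.ne_one
      have hk0 : k ≠ 0 := by
        rintro rfl
        rw [pow_zero, one_mul] at hk
        exact hpM (hk ▸ hpN)
      obtain ⟨n, rfl⟩ := Nat.exists_eq_succ_of_ne_zero hk0
      have hM0 : M ≠ 0 := fun h ↦ hpM (h ▸ dvd_zero p)
      have hM : M.Coprime p := (hp.coprime_iff_not_dvd.mpr hpM).symm
      obtain ⟨C, hC⟩ := (hE p hpN).exists_isSupersingularModelAt
      -- The point `P'` has order `M`, so the inductive hypothesis computes the degree of `K`.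
      obtain ⟨K, _, _, _, P', hP', hgen'⟩ := exists_numberField_map_eq (p ^ (n + 1) • P)
      obtain ⟨-, hLK⟩ := ramificationIdx_and_finrank hM hC (hP.trans hk) hM0 hgen hP' hgen'
      have hordP' : addOrderOf P' = M := by
        rw [← addOrderOf_injective _ (map_injective (IsScalarTower.toAlgHom ℚ K L)) P', hP',
          addOrderOf_nsmul' P (by positivity [hp.pos]), hP, hk,
          Nat.gcd_eq_right (dvd_mul_right _ _),
          Nat.mul_div_cancel_left _ (by positivity [hp.pos])]
      have hMN : M < N := by
        rw [hk]
        exact lt_mul_of_one_lt_left (Nat.pos_of_ne_zero hM0) (Nat.one_lt_pow (by omega) hp.one_lt)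
      have hK := ih M hMN hM0 (fun q _ hq ↦ hE q (hq.trans (hk ▸ dvd_mul_left _ _))) hordP' hgen'
      have hcop : Nat.Coprime (p ^ (n + 1)) M := (hM.pow_right _).symm
      have hpf : (p ^ (n + 1)).primeFactors = {p} := Nat.primeFactors_prime_pow n.succ_ne_zero hp
      rw [← Module.finrank_mul_finrank ℚ K L, hK, hLK, hk, hcop.primeFactors_mul, hpf,
        Finset.prod_union (by simpa [hpf] using hcop.disjoint_primeFactors), Finset.prod_singleton,
        mul_comm]
      congr 1
      · have : (p ^ (n + 1) * M).factorization p = n + 1 := by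
          rw [Nat.factorization_mul (by positivity [hp.pos]) hM0, hp.factorization_pow]
          simp [Nat.factorization_eq_zero_of_not_dvd hpM]
        rw [this]
      · refine Finset.prod_congr rfl fun q hq ↦ ?_
        have : (p ^ (n + 1) * M).factorization q = M.factorization q := by
          rw [Nat.factorization_mul (by positivity [hp.pos]) hM0, hp.factorization_pow]
          have : p ≠ q := by
            rintro rfl
            exact hpM (Nat.dvd_of_mem_primeFactors hq)
          simp [this]
        rw [this]

open scoped Classical in
/-- A minimal torsion point field is generated by the coordinates of a torsion point. -/
lemma exists_adjoin_eq_top_of_isMinimalTorsionPointField {E : WeierstrassCurve ℚ} {N : ℕ}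
    {L : Type u} [Field L] [NumberField L] (hL : E.IsMinimalTorsionPointField N L) :
    ∃ P : (E⁄L).toAffine.Point, addOrderOf P = N ∧
      IntermediateField.adjoin ℚ {P.xCoord, P.yCoord} = ⊤ := by
  obtain ⟨⟨P, hP⟩, hmin⟩ := hL
  obtain ⟨K, _, _, _, P', hP', hgen'⟩ := exists_numberField_map_eq P
  have hordP' : addOrderOf P' = N := by
    rw [← addOrderOf_injective _ (map_injective (IsScalarTower.toAlgHom ℚ K L)) P', hP', hP]
  have hle := hmin K ⟨P', hordP'⟩
  refine ⟨P, hP, ?_⟩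
  -- Minimality gives `[L : ℚ] ≤ [K : ℚ]`, so the embedding of the field of definition is onto.
  have hsurj : Function.Surjective (IsScalarTower.toAlgHom ℚ K L) := by
    have hinj := (IsScalarTower.toAlgHom ℚ K L).injective
    exact (LinearMap.injective_iff_surjective_of_finrank_eq_finrank
      (f := (IsScalarTower.toAlgHom ℚ K L).toLinearMap)
      (le_antisymm (LinearMap.finrank_le_finrank_of_injective (f :=
        (IsScalarTower.toAlgHom ℚ K L).toLinearMap) hinj) hle)).mp hinj
  rw [← hP', xCoord_map, yCoord_map, ← Set.image_pair, ← IntermediateField.adjoin_map, hgen',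
    ← AlgHom.fieldRange_eq_map, AlgHom.fieldRange_eq_top]
  exact hsurj

end WeierstrassCurve.Affine.Point

theorem mainTheorem7 {N : ℕ} (hN : 1 < N) (E : WeierstrassCurve ℚ) [E.IsElliptic]
    (hE : ∀ (p : ℕ) [Fact p.Prime], p ∣ N → E.HasSupersingularReductionAt p)
    (L : Type*) [Field L] [NumberField L] (hL : E.IsMinimalTorsionPointField N L) :
    (∀ p : ℕ, p.Prime → p ∣ N →
      ∀ P : Ideal (𝓞 L), P.IsPrime → P.LiesOver (Ideal.span {(p : ℤ)}) →
        P.ramificationIdx ℤ = p ^ (2 * N.factorization p) - p ^ (2 * N.factorization p - 2)) ∧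
      Module.finrank ℚ L =
        ∏ p ∈ N.primeFactors,
          (p ^ (2 * N.factorization p) - p ^ (2 * N.factorization p - 2)) := by
  classical
  obtain ⟨P, hP, hgen⟩ :=
    WeierstrassCurve.Affine.Point.exists_adjoin_eq_top_of_isMinimalTorsionPointField hL
  refine ⟨fun p hp hpN 𝔓 _ _ ↦ ?_,
    WeierstrassCurve.Affine.Point.finrank_eq_prod (by omega) hE hP hgen⟩
  have := Fact.mk hp
  obtain ⟨C, hC⟩ := (hE p hpN).exists_isSupersingularModelAt
  have hN0 : N ≠ 0 := by omega
  have hk0 : N.factorization p ≠ 0 := (hp.factorization_pos_of_dvd hN0 hpN).ne'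
  obtain ⟨n, hn⟩ := Nat.exists_eq_succ_of_ne_zero hk0
  obtain ⟨K, _, _, _, P', hP', hgen'⟩ :=
    WeierstrassCurve.Affine.Point.exists_numberField_map_eq (p ^ (n + 1) • P)
  rw [hn]
  refine (WeierstrassCurve.Affine.Point.ramificationIdx_and_finrank
    (M := N / p ^ (n + 1)) ?_ hC (hP.trans ?_) ?_ hgen hP' hgen').1 𝔓
  · rw [← Nat.succ_eq_add_one, ← hn]
    exact (Nat.coprime_ordCompl hp hN0).symm
  · rw [← Nat.succ_eq_add_one, ← hn]
    exact (Nat.ordProj_mul_ordCompl_eq_self N p).symm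
  · rw [← Nat.succ_eq_add_one, ← hn]
    exact (Nat.ordCompl_pos p hN0).ne'
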